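/- **Setting.** Let $\mathcal P$ be a finite simple graph (the *prototype*); its vertices are called *blobs* and its edges *bands*. A *blow-up* $G$ of $\mathcal P$ is obtained by replacing every blob by a nonempty complete or empty graph and every band by all edges between the vertices of its two blobs; the edges of $G$ carry arbitrary rational weights. $G$ has $2n$ vertices, $n\ge 2$. For a matching $M$, $|M|_k$ is the total weight of its $k$ heaviest edges, and for a band $B$, $E(B)$ is the set of edges of $G$ created from $B$. The *bandwidth* of $\mathcal P$ is the least $b$ for which the blobs can be linearly ordered so that adjacent blobs are at most $b$ positions apart. Running time is the number of elementary steps on a random access machine with unit-cost arithmetic. **Algorithm 1** (input: $k$ and a graph with vertex set partitioned into types $V_1,\dots,V_\gamma$). For all $(c_1,\dots,c_\gamma)\in\mathbb N^\gamma$ with $\sum_i c_i=2k$ (tuples with some $c_i>|V_i|$ are discarded): add for each $i$ a set $K_i$ of $|V_i|-c_i$ new vertices joined to all of $V_i$ by edges of weight $0$, compute a maximum weight perfect matching of this graph, and let $M'$ be its set of original edges; if the graph without the vertices touched by $M'$ has a perfect matching $M''$, and no solution has been stored so far or the stored one has smaller $|\cdot|_k$ than $M'$, store $M'\cup M''$.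 Return the stored solution. Maximum weight perfect matchings, and perfect matchings, are computed by Edmonds' algorithms. **Algorithm 3** (input: $k\le n$, $\mathcal P$, an integer $\varphi$, $G$, a set $\mathcal T$ of bands called tight with $|\mathcal T|\le\sqrt n$, and $n$; $C$ is a fixed constant). If $G$ has no perfect matching, return nothing. If $2|\mathcal T|\ge\lfloor(|V(\mathcal P)|/2-3)/\varphi\rfloor$ or $|V(\mathcal P)|\le C$, return the output of Algorithm 1 on $(k,G)$ with the blobs as types. Otherwise, by trying all sets of at most $\varphi$ blobs, find a separator $\mathcal S$ of $\mathcal P$ that no band of $\mathcal T$ touches, with $|\mathcal S|\le\varphi$, which separates $\mathcal P$ into $\mathcal P_1,\mathcal P_2$ with $|V(\mathcal P_i)|\in[\frac14|V(\mathcal P)|,\frac34|V(\mathcal P)|]$. For every set $E'$ of edges of $G$ created from bands touching $\mathcal S$, with $|E'\cap E(B)|\le\sqrt n$ for each band $B$, and for every $(k',k_{\rm blobs},k_1,k_2)\in[0,k]^4$ with sum $k$: for $i=1,2$ let $G_i$ be the subgraph of $G$ induced by the vertices in blobs of $\mathcal P_i$ that $E'$ does not touch, and let $M_i$ be the result of the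 recursive call on $(k_i,\mathcal P_i,\varphi,G_i,\mathcal T\cap E(\mathcal P_i),n)$. If $M_1$ and $M_2$ exist and $E'\cup M_1\cup M_2$ extends to a perfect matching of $G$, call Algorithm 1 with parameter $k_{\rm blobs}$ on the graph of the vertices in blobs of $\mathcal S$ not touched by $E'$ and the edges within single blobs, with the blobs of $\mathcal S$ as types; if it returns a matching, add it to $E'\cup M_1\cup M_2$ and keep the best matching with respect to $|\cdot|_k$ found so far. Return the best matching. **Theorem.** For every constant $C$ there is a constant $c>0$ such that for all $n\ge2$ and $\varphi\ge1$, Algorithm 3 takes at most $2^{c\,\varphi^2\sqrt n\,\log_2^2 n}$ steps on every input as above whose prototype has bandwidth at most $\varphi$; that is, it runs in time $2^{O(\varphi^2\sqrt n\log^2 n)}$. In particular, the running time is subexponential for $\varphi=o(n^{1/4}/\log n)$: for every function $\varphi:\mathbb N\to\mathbb N$ with $\varphi(n)=o(n^{1/4}/\log n)$ there is a function $g(n)=o(n)$ such that for all sufficiently large $n$ with $\varphi(n)\ge1$, Algorithm 3 takes at most $2^{g(n)}$ steps on every such input whose prototype has bandwidth at most $\varphi(n)$. -/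

import Mathlib

/-! ## The cost model

Algorithms are written in the monad `Timed`, which counts elementary steps. As on a
random access machine with unit-cost arithmetic, an elementary step may perform boundedly many
operations on numbers (arithmetic, comparison), on vertex names (equality test, table
look-up), and on list cells (construct a cell, inspect the first cell). Every iteration of every
loop and every recursive call pays at least one `tick`; no list is ever traversed for free. -/

structure Timed (α : Type) where
  /-- the result of the computation -/
  val : α
  /-- the number of elementary steps the computation took -/
  time : ℕ

namespace Timed

instance : Monad Timed where
  pure a := ⟨a, 0⟩
  bind x f := let y := f x.val; ⟨y.val, x.time + y.time⟩

/-- One elementary step. -/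
def tick : Timed Unit := ⟨(), 1⟩

end Timed

namespace TkPM

open Timed

/-! ## Loops over lists -/

def mapT {α β : Type} (f : α → Timed β) : List α → Timed (List β)
  | [] => do tick; return []
  | a :: l => do
    tick
    let b ← f a
    let bs ← mapT f l
    return b :: bs

def filterT {α : Type} (p : α → Timed Bool) : List α → Timed (List α)
  | [] => do tick; return []
  | a :: l => do
    tick
    let b ← p a
    let r ← filterT p l
    return if b then a :: r else r

def filterMapT {α β : Type} (f : α → Timed (Option β)) : List α → Timed (List β)
  | [] => do tick; return []
  | a :: l => do
    tick
    let b ← f a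
    let r ← filterMapT f l
    return match b with
      | none => r
      | some c => c :: r

/-- Loop over a list from left to right, updating a state. -/
def foldT {α β : Type} (f : β → α → Timed β) : β → List α → Timed β
  | b, [] => do tick; return b
  | b, a :: l => do
    tick
    let b₁ ← f b a
    foldT f b₁ l

def findT {α : Type} (p : α → Timed Bool) : List α → Timed (Option α)
  | [] => do tick; return none
  | a :: l => do
    tick
    if ← p a then return some a else findT p l

def anyT {α : Type} (p : α → Timed Bool) (l : List α) : Timed Bool := do
  return (← findT p l).isSome

def elemT {α : Type} [DecidableEq α] (a : α) (l : List α) : Timed Bool :=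
  anyT (fun b => return decide (a = b)) l

def appendT {α : Type} : List α → List α → Timed (List α)
  | [], r => do tick; return r
  | a :: l, r => do
    tick
    let s ← appendT l r
    return a :: s

def flattenT {α : Type} : List (List α) → Timed (List α)
  | [] => do tick; return []
  | a :: l => do
    tick
    let r ← flattenT l
    appendT a r

def lengthT {α : Type} (l : List α) : Timed ℕ :=
  foldT (fun s _ => return s + 1) 0 l

def reverseT {α : Type} (l : List α) : Timed (List α) :=
  foldT (fun r a => return a :: r) [] l

/-- The list `a, a + 1, …, a + (j - 1)`. -/
def rangeFromT (a : ℕ) : ℕ → Timed (List ℕ)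
  | 0 => do tick; return []
  | j + 1 => do
    tick
    let r ← rangeFromT (a + 1) j
    return a :: r

/-- `⌊√n⌋`. -/
def sqrtT (n : ℕ) : Timed ℕ := do
  let l ← rangeFromT 0 (n + 1)
  foldT (fun s r => return if r * r ≤ n then r else s) 0 l

/-- All sublists of `l` with at most `r` entries. -/
def subsetsT {α : Type} : List α → ℕ → Timed (List (List α))
  | [], _ => do tick; return [[]]
  | _ :: _, 0 => do tick; return [[]]
  | a :: l, r + 1 => do
    tick
    let without ← subsetsT l (r + 1)
    let smaller ← subsetsT l r
    let withA ← mapT (fun s => return a :: s) smaller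
    appendT without withA

/-- All tuples of `g` natural numbers with sum `s`. -/
def tuplesT : ℕ → ℕ → Timed (List (List ℕ))
  | 0, 0 => do tick; return [[]]
  | 0, _ + 1 => do tick; return []
  | g + 1, s => do
    tick
    let firsts ← rangeFromT 0 (s + 1)
    let parts ← mapT (fun j => do
      let rests ← tuplesT g (s - j)
      mapT (fun c => return j :: c) rests) firsts
    flattenT parts

/-- Vertex sets of the connected components of the graph with vertex list `V` and edge list `E`. -/
def componentsT {α : Type} [DecidableEq α] (V : List α) (E : List (α × α)) :
    Timed (List (List α)) := do
  let start ← mapT (fun v => return [v]) V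
  foldT (fun comps e => do
    let hit ← filterT (fun K => do
      let b ← elemT e.1 K
      let c ← elemT e.2 K
      return b || c) comps
    let rest ← filterT (fun K => do
      let b ← elemT e.1 K
      let c ← elemT e.2 K
      return !(b || c)) comps
    let K ← flattenT hit
    return K :: rest) start E

/-! ## Maximum matching in (unweighted) graphs

Edmonds' algorithm. Graphs are given by a list of vertices and a list of edges; parallel edges may
occur, loops may not. -/

def neighboursT {α : Type} [DecidableEq α] (E : List (α × α)) (v : α) : Timed (List α) :=
  filterMapT (fun e =>
    return (if e.1 = v then some e.2 else if e.2 = v then some e.1 else none)) E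

def coversT {α : Type} [DecidableEq α] (M : List (α × α)) (v : α) : Timed Bool :=
  anyT (fun e => return decide (e.1 = v ∨ e.2 = v)) M

/-- Breadth first search for a shortest alternating walk between exposed vertices. The queue holds
alternating walks of even length, last vertex first, starting in the set `X` of exposed vertices;
`seen` holds their end vertices. The first argument bounds the number of rounds; every round
removes a walk from the queue, and no two walks in it ever end in the same vertex. -/
def alternatingWalkT {α : Type} [DecidableEq α] (E M : List (α × α)) (X : List α) :
    ℕ → List (List α) → List α → Timed (Option (List α))
  | 0, _, _ => do tick; return none
  | _ + 1, [], _ => do tick; return none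
  | _ + 1, [] :: _, _ => do tick; return none
  | r + 1, (v :: W) :: queue, seen => do
    tick
    let N ← neighboursT E v
    match ← findT (fun u => elemT u X) N with
    | some u => return some (u :: v :: W)
    | none =>
      let next ← foldT (fun (s : List (List α) × List α) u => do
        match ← neighboursT M u with
        | [] => return s
        | x :: _ =>
          if ← elemT x s.2 then return s
          else return ((x :: u :: v :: W) :: s.1, x :: s.2)) ([], seen) N
      let fresh ← reverseT next.1
      let queue₁ ← appendT queue fresh
      alternatingWalkT E M X r queue₁ next.2

/-- The part of `l` up to and including the first occurrence of `a`. -/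
def takeToT {α : Type} [DecidableEq α] (a : α) : List α → Timed (List α)
  | [] => do tick; return []
  | b :: l => do
    tick
    if a = b then return [b]
    else
      let r ← takeToT a l
      return b :: r

/-- The vertices on the first closed section of a walk, if some vertex repeats; `past` is the part
already traversed, last vertex first. -/
def firstCycleT {α : Type} [DecidableEq α] (past : List α) : List α → Timed (Option (List α))
  | [] => do tick; return none
  | a :: l => do
    tick
    if ← elemT a past then
      let B ← takeToT a past
      return some B
    else firstCycleT (a :: past) l

/-- Shrink the vertex set `B` to the single vertex `c`. -/
def shrinkEdgesT {α : Type} [DecidableEq α] (B : List α) (c : α) (E : List (α × α)) :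
    Timed (List (α × α)) := do
  let E₁ ← mapT (fun e => do
    let a ← elemT e.1 B
    let b ← elemT e.2 B
    return (if a then c else e.1, if b then c else e.2)) E
  filterT (fun e => return decide (e.1 ≠ e.2)) E₁

/-- Whether the matching `M` of the graph `(V, E)` is augmentable, that is, not of maximum size. If a
shortest alternating walk between exposed vertices is not a path then it contains a blossom, which
is shrunk. The first argument bounds the number of shrinkings and is always at least the number of
vertices. -/
def augmentableT {α : Type} [DecidableEq α] :
    ℕ → List α → List (α × α) → List (α × α) → Timed Bool
  | 0, _, _, _ => do tick; return false
  | r + 1, V, E, M => do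
    tick
    let X ← filterT (fun v => do
      let b ← coversT M v
      return !b) V
    let start ← mapT (fun v => return [v]) X
    let size ← lengthT V
    match ← alternatingWalkT E M X (size + 1) start X with
    | none => return false
    | some W =>
      let walk ← reverseT W
      match ← firstCycleT [] walk with
      | none => return true
      | some [] => return true
      | some (c :: B) =>
        let V₁ ← filterT (fun v => do
          let b ← elemT v B
          return !b) V
        let E₁ ← shrinkEdgesT (c :: B) c E
        let M₁ ← shrinkEdgesT (c :: B) c M
        augmentableT r V₁ E₁ M₁

/-- Remove edges outside of the matching `M` as long as `M` stays augmentable. What remains are the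
non-matching edges of an augmenting path. -/
def pruneT {α : Type} [DecidableEq α] (size : ℕ) (V : List α) (M : List (α × α)) :
    List (α × α) → List (α × α) → Timed (List (α × α))
  | kept, [] => do tick; return kept
  | kept, e :: rest => do
    tick
    let E₀ ← appendT kept rest
    let E₁ ← appendT E₀ M
    if ← augmentableT (size + 1) V E₁ M then pruneT size V M kept rest
    else pruneT size V M (e :: kept) rest

/-- Augment the matching `M` along an augmenting path. -/
def augmentT {α : Type} [DecidableEq α] (size : ℕ) (V : List α) (E M : List (α × α)) :
    Timed (List (α × α)) := do
  let E₁ ← filterT (fun e => do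
    let b ← elemT e M
    let c ← elemT (e.2, e.1) M
    return !(b || c)) E
  let path ← pruneT size V M [] E₁
  let stay ← filterT (fun e => do
    let b ← coversT path e.1
    let c ← coversT path e.2
    return !(b || c)) M
  appendT path stay

def maximumMatchingLoopT {α : Type} [DecidableEq α] (size : ℕ) (V : List α) (E : List (α × α)) :
    ℕ → List (α × α) → Timed (List (α × α))
  | 0, M => do tick; return M
  | r + 1, M => do
    tick
    if ← augmentableT (size + 1) V E M then
      let M₁ ← augmentT size V E M
      maximumMatchingLoopT size V E r M₁
    else return M

/-- A matching of maximum size. -/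
def maximumMatchingT {α : Type} [DecidableEq α] (V : List α) (E : List (α × α)) :
    Timed (List (α × α)) := do
  let size ← lengthT V
  maximumMatchingLoopT size V E size []

/-! ## Weighted edges -/

/-- An edge between `u` and `v` with weight `w`. -/
structure WEdge (α : Type) where
  u : α
  v : α
  w : ℚ

def touchesT {α : Type} [DecidableEq α] (M : List (WEdge α)) (x : α) : Timed Bool :=
  anyT (fun e => return decide (e.u = x ∨ e.v = x)) M

/-- The edges of `E` with both ends in `V`. -/
def inducedT {α : Type} [DecidableEq α] (V : List α) (E : List (WEdge α)) :
    Timed (List (WEdge α)) :=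
  filterT (fun e => do
    let a ← elemT e.u V
    let b ← elemT e.v V
    return a && b) E

/-- The vertices of `V` that no edge of `M` touches. -/
def untouchedT {α : Type} [DecidableEq α] (V : List α) (M : List (WEdge α)) : Timed (List α) :=
  filterT (fun x => do
    let b ← touchesT M x
    return !b) V

/-- A perfect matching of the graph `(V, E)`, `none` if there is none. -/
def perfectMatchingT {α : Type} [DecidableEq α] (V : List α) (E : List (WEdge α)) :
    Timed (Option (List (WEdge α))) := do
  let E₁ ← mapT (fun e => return (e.u, e.v)) E
  let M ← maximumMatchingT V E₁
  let s ← lengthT M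
  let t ← lengthT V
  if 2 * s = t then
    let M₁ ← filterMapT (fun p => findT (fun e => return decide (e.u = p.1 ∧ e.v = p.2)) E) M
    return some M₁
  else return none

def insertT (q : ℚ) : List ℚ → Timed (List ℚ)
  | [] => do tick; return [q]
  | r :: l => do
    tick
    if r ≤ q then return q :: r :: l
    else
      let s ← insertT q l
      return r :: s

/-- The sum of the first `k` entries. -/
def sumFirstT : ℕ → List ℚ → Timed ℚ
  | 0, _ => do tick; return 0
  | _ + 1, [] => do tick; return 0
  | k + 1, q :: l => do
    tick
    let s ← sumFirstT k l
    return q + s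

/-- The total weight of the `k` heaviest edges of `M`. -/
def topkT {α : Type} (k : ℕ) (M : List (WEdge α)) : Timed ℚ := do
  let sorted ← foldT (fun l (e : WEdge α) => insertT e.w l) [] M
  sumFirstT k sorted

/-! ## Maximum weight perfect matching

Edmonds' primal-dual method. Dual variables are a number `y x` for every vertex `x` and a positive
number `z` for every set in a laminar family of odd vertex sets (blossoms). An edge `e = uv` is tight
if its slack `y u + y v + ∑ z B - w e`, the sum being over the blossoms `B` that contain both ends, is
zero; all slacks are nonnegative throughout. -/

structure Blossom (α : Type) where
  /-- a vertex of the blossom, which stands for it when it is shrunk -/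
  rep : α
  verts : List α
  z : ℚ

def lookupT {α : Type} [DecidableEq α] (y : List (α × ℚ)) (x : α) : Timed ℚ := do
  return match ← findT (fun p => return decide (p.1 = x)) y with
    | none => 0
    | some p => p.2

/-- The node to which `x` is shrunk when the blossoms in `F` are shrunk. In the list `F` a blossom
always precedes the blossoms that it contains. -/
def nodeT {α : Type} [DecidableEq α] (F : List (Blossom α)) (x : α) : Timed α := do
  return match ← findT (fun B => elemT x B.verts) F with
    | none => x
    | some B => B.rep

def slackT {α : Type} [DecidableEq α] (y : List (α × ℚ)) (F : List (Blossom α)) (e : WEdge α) :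
    Timed ℚ := do
  let a ← lookupT y e.u
  let b ← lookupT y e.v
  foldT (fun s B => do
    let c ← elemT e.u B.verts
    let d ← elemT e.v B.verts
    return if c && d then s + B.z else s) (a + b - e.w) F

/-- Every edge that survives the shrinking of `F`, together with the two nodes it joins. -/
def shrunkEdgesT {α : Type} [DecidableEq α] (F : List (Blossom α)) (E : List (WEdge α)) :
    Timed (List (WEdge α × α × α)) :=
  filterMapT (fun e => do
    let a ← nodeT F e.u
    let b ← nodeT F e.v
    return if a = b then none else some (e, a, b)) E

/-- For every pair of nodes in `M` an edge joining them. -/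
def liftT {α : Type} [DecidableEq α] (L : List (WEdge α × α × α)) (M : List (α × α)) :
    Timed (List (WEdge α)) :=
  filterMapT (fun p => do
    let r ← findT (fun (t : WEdge α × α × α) => return decide (t.2 = p)) L
    return r.map Prod.fst) M

/-- Extend a perfect matching `N` of the shrunk graph to the interior of the blossoms, from the outside
inwards, through tight edges. -/
def expandT {α : Type} [DecidableEq α] (tight : List (WEdge α)) :
    List (Blossom α) → List (WEdge α) → Timed (List (WEdge α))
  | [], N => do tick; return N
  | B :: F, N => do
    tick
    let covered ← filterT (touchesT N) B.verts
    let removed ← mapT (nodeT F) covered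
    let nodes ← filterT (fun x => do
      let a ← nodeT F x
      let b ← elemT x removed
      return decide (a = x) && !b) B.verts
    let inside ← inducedT B.verts tight
    let shrunk ← shrunkEdgesT F inside
    let L ← filterT (fun t => do
      let a ← elemT t.2.1 nodes
      let b ← elemT t.2.2 nodes
      return a && b) shrunk
    let E₁ ← mapT (fun t => return t.2) L
    let M ← maximumMatchingT nodes E₁
    let N₁ ← liftT L M
    let N₂ ← appendT N₁ N
    expandT tight F N₂

/-- The nodes that some maximum matching leaves exposed; `M` is a maximum matching. -/
def inessentialT {α : Type} [DecidableEq α] (V : List α) (E M : List (α × α)) :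
    Timed (List α) := do
  let size ← lengthT V
  filterT (fun x => do
    if ← coversT M x then
      let V₁ ← filterT (fun v => return decide (v ≠ x)) V
      let E₁ ← filterT (fun e => return decide (e.1 ≠ x ∧ e.2 ≠ x)) E
      let M₁ ← filterT (fun e => return decide (e.1 ≠ x ∧ e.2 ≠ x)) M
      augmentableT (size + 1) V₁ E₁ M₁
    else return true) V

/-- Split a laminar family into its maximal members and the others. Entries are tagged with `true` if
they are maximal. -/
def tagMaximalT {α : Type} [DecidableEq α] (F : List (Blossom α)) :
    Timed (List (Blossom α × Bool)) := do
  let r ← foldT (fun (s : List (Blossom α × Bool) × List α) B => do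
    let b ← elemT B.rep s.2
    let past ← appendT B.verts s.2
    return ((B, !b) :: s.1, past)) ([], []) F
  reverseT r.1

def minT (l : List ℚ) : Timed (Option ℚ) :=
  foldT (fun s q => return match s with
    | none => some q
    | some r => some (if q ≤ r then q else r)) none l

/-- One dual change. `L` are the edges of the shrunk graph, `D` its inessential nodes, `K` the
components of the tight subgraph on `D`, and `A` the other nodes with a tight edge to `D`. The result
is `none` if the dual problem is unbounded, which means that there is no perfect matching. -/
def dualChangeT {α : Type} [DecidableEq α] (V : List α) (y : List (α × ℚ)) (F : List (Blossom α))
    (L : List (WEdge α × α × α)) (D A : List α) (K : List (List α)) :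
    Timed (Option (List (α × ℚ) × List (Blossom α))) := do
  let tagged ← tagMaximalT F
  let edgeBounds ← filterMapT (fun (t : WEdge α × α × α) => do
    let s ← slackT y F t.1
    let a ← elemT t.2.1 D
    let b ← elemT t.2.2 D
    let c ← elemT t.2.1 A
    let d ← elemT t.2.2 A
    if a && b then
      let same ← anyT (fun C => do
        let p ← elemT t.2.1 C
        let q ← elemT t.2.2 C
        return p && q) K
      return if same then none else some (s / 2)
    else return if (a && !d) || (b && !c) then some s else none) L
  let blossomBounds ← filterMapT (fun (t : Blossom α × Bool) => do
    let a ← elemT t.1.rep A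
    return if t.2 && a then some (t.1.z / 2) else none) tagged
  let bounds ← appendT edgeBounds blossomBounds
  match ← minT bounds with
  | none => return none
  | some δ =>
    let y₁ ← mapT (fun (p : α × ℚ) => do
      let x ← nodeT F p.1
      let a ← elemT x D
      let b ← elemT x A
      return (p.1, if a then p.2 - δ else if b then p.2 + δ else p.2)) y
    let old ← mapT (fun (t : Blossom α × Bool) => do
      let a ← elemT t.1.rep A
      let alone ← anyT (fun C => return match C with
        | [x] => decide (x = t.1.rep)
        | _ => false) K
      return { t.1 with z := if t.2 then
        (if a then t.1.z - 2 * δ else if alone then t.1.z + 2 * δ else t.1.z) else t.1.z }) tagged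
    let old₁ ← filterT (fun (B : Blossom α) => return decide (B.z ≠ 0)) old
    let new ← filterMapT (fun C => do
      match C with
      | x :: _ :: _ =>
        let verts ← filterT (fun v => do
          let a ← nodeT F v
          elemT a C) V
        return some ⟨x, verts, 2 * δ⟩
      | _ => return none) K
    let F₁ ← appendT new old₁
    return some (y₁, F₁)

/-- The primal-dual loop. As long as the tight edges of the shrunk graph admit no perfect matching, the
dual solution is changed along the Gallai–Edmonds decomposition of that graph. The number of exposed
nodes never increases; while it stays the same, every change enlarges the set of vertices in
inessential nodes or dissolves a blossom that was present when it last dropped. Hence fewer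
than `4 * (|V| + 1) ^ 2` rounds are needed. -/
def weightedLoopT {α : Type} [DecidableEq α] (V : List α) (E : List (WEdge α)) :
    ℕ → List (α × ℚ) → List (Blossom α) → Timed (Option (List (WEdge α)))
  | 0, _, _ => do tick; return none
  | r + 1, y, F => do
    tick
    let tight ← filterT (fun e => do
      let s ← slackT y F e
      return decide (s = 0)) E
    let nodes ← filterT (fun x => do
      let a ← nodeT F x
      return decide (a = x)) V
    let LT ← shrunkEdgesT F tight
    let H ← mapT (fun t => return t.2) LT
    let M ← maximumMatchingT nodes H
    let s ← lengthT M
    let t ← lengthT nodes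
    if 2 * s = t then
      let N ← liftT LT M
      let R ← expandT tight F N
      return some R
    else
      let D ← inessentialT nodes H M
      let HD ← filterT (fun e => do
        let a ← elemT e.1 D
        let b ← elemT e.2 D
        return a && b) H
      let K ← componentsT D HD
      let A ← filterT (fun x => do
        let a ← elemT x D
        let N ← neighboursT H x
        let b ← anyT (fun v => elemT v D) N
        return !a && b) nodes
      let L ← shrunkEdgesT F E
      match ← dualChangeT V y F L D A K with
      | none => return none
      | some (y₁, F₁) => weightedLoopT V E r y₁ F₁

/-- A perfect matching of maximum total weight, `none` if there is no perfect matching. -/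
def maximumWeightPerfectMatchingT {α : Type} [DecidableEq α] (V : List α) (E : List (WEdge α)) :
    Timed (Option (List (WEdge α))) := do
  let size ← lengthT V
  let W ← foldT (fun s (e : WEdge α) => return if s ≤ e.w then e.w else s) 0 E
  let y ← mapT (fun x => return (x, W / 2)) V
  weightedLoopT V E (4 * (size + 1) ^ 2) y []

/-! ## Top-k perfect matching for bounded neighbourhood diversity -/

/-- The vertex sets `V i`, numbered from `i` on, together with the numbers `c i` of vertices to be
touched and the new vertices `K i`, of which there are `|V i| - c i`; `none` if `c i > |V i|` for
some `i`. The new vertices are named by pairs of numbers. -/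
def killersT {α : Type} : ℕ → List (List α) → List ℕ →
    Timed (Option (List (List α × List (ℕ × ℕ))))
  | _, [], _ => do tick; return some []
  | _, _ :: _, [] => do tick; return none
  | i, U :: types, c :: cs => do
    tick
    let s ← lengthT U
    if s < c then return none
    else
      let js ← rangeFromT 0 (s - c)
      let K ← mapT (fun j => return (i, j)) js
      match ← killersT (i + 1) types cs with
      | none => return none
      | some r => return some ((U, K) :: r)

/-- A matching of maximum weight among those that touch exactly `c i` vertices of the `i`-th type,
found by a maximum weight perfect matching in the graph with `|V i| - c i` new vertices joined to
all of `V i` by edges of weight zero. -/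
def typeConstrainedT {α : Type} [DecidableEq α] (types : List (List α)) (E : List (WEdge α))
    (c : List ℕ) : Timed (Option (List (WEdge α))) := do
  match ← killersT 0 types c with
  | none => return none
  | some parts =>
    let V ← flattenT types
    let V₁ ← mapT (fun x => return (Sum.inl x : α ⊕ (ℕ × ℕ))) V
    let Ks ← mapT (fun (p : List α × List (ℕ × ℕ)) =>
      mapT (fun x => return (Sum.inr x : α ⊕ (ℕ × ℕ))) p.2) parts
    let V₂ ← flattenT Ks
    let V₃ ← appendT V₁ V₂
    let E₁ ← mapT (fun e => return (⟨Sum.inl e.u, Sum.inl e.v, e.w⟩ : WEdge (α ⊕ (ℕ × ℕ)))) E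
    let Es ← mapT (fun (p : List α × List (ℕ × ℕ)) => do
      let l ← mapT (fun x =>
        mapT (fun q => return (⟨Sum.inl x, Sum.inr q, 0⟩ : WEdge (α ⊕ (ℕ × ℕ)))) p.2) p.1
      flattenT l) parts
    let E₂ ← flattenT Es
    let E₃ ← appendT E₁ E₂
    match ← maximumWeightPerfectMatchingT V₃ E₃ with
    | none => return none
    | some M =>
      let N ← filterMapT (fun (e : WEdge (α ⊕ (ℕ × ℕ))) => return match e.u, e.v with
        | Sum.inl a, Sum.inl b => some ⟨a, b, e.w⟩
        | _, _ => none) M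
      return some N

/-- Whether `M` beats the best solution so far. -/
def betterT {α : Type} (k : ℕ) (M : List (WEdge α)) : Option (List (WEdge α)) → Timed Bool
  | none => do tick; return true
  | some B => do
    tick
    let a ← topkT k M
    let b ← topkT k B
    return decide (b < a)

/-- The algorithm for bounded neighbourhood diversity: the graph has edge list `E`, and `types` is a
partition of its vertex set into types. The value `none` says that no perfect matching was found. -/
def basicT {α : Type} [DecidableEq α] (k : ℕ) (types : List (List α)) (E : List (WEdge α)) :
    Timed (Option (List (WEdge α))) := do
  let γ ← lengthT types
  let V ← flattenT types
  let cs ← tuplesT γ (2 * k)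
  foldT (fun best c => do
    match ← typeConstrainedT types E c with
    | none => return best
    | some M =>
      let V₁ ← untouchedT V M
      let E₁ ← inducedT V₁ E
      match ← perfectMatchingT V₁ E₁ with
      | none => return best
      | some M₁ =>
        if ← betterT k M best then
          let R ← appendT M M₁
          return some R
        else return best) none cs

/-! ## Loose separators -/

/-- Distribute the components in all possible ways to two sides, keeping one way for each size of the
first side. A way is recorded with that size. -/
def splitsT {ι : Type} (comps : List (List ι)) : Timed (List (ℕ × List ι × List ι)) :=
  foldT (fun ways K => do
    let s ← lengthT K
    let right ← mapT (fun (x : ℕ × List ι × List ι) => do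
      let R ← appendT K x.2.2
      return (x.1, x.2.1, R)) ways
    let left ← mapT (fun (x : ℕ × List ι × List ι) => do
      let L ← appendT K x.2.1
      return (x.1 + s, L, x.2.2)) ways
    let all ← appendT right left
    foldT (fun kept (x : ℕ × List ι × List ι) => do
      let b ← anyT (fun (t : ℕ × List ι × List ι) => return decide (t.1 = x.1)) kept
      return if b then kept else x :: kept) [] all) [(0, [], [])] comps

/-- A loose separator of the prototype `(V, E)` with respect to the tight bands `T`, found by trying all
sets of at most `φ` blobs. The result consists of the separator and the two parts, each of
which has between a quarter and three quarters of all blobs. -/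
def looseSeparatorT {ι : Type} [DecidableEq ι] (φ : ℕ) (V : List ι) (E T : List (ι × ι)) :
    Timed (Option (List ι × List ι × List ι)) := do
  let size ← lengthT V
  let candidates ← subsetsT V φ
  foldT (fun found S => do
    match found with
    | some _ => return found
    | none =>
      if ← anyT (fun x => coversT T x) S then return none
      else
        let V₁ ← filterT (fun v => do
          let b ← elemT v S
          return !b) V
        let E₁ ← filterT (fun e => do
          let a ← elemT e.1 S
          let b ← elemT e.2 S
          return !(a || b)) E
        let comps ← componentsT V₁ E₁
        let ways ← splitsT comps
        let rest ← lengthT V₁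
        let r ← findT (fun (x : ℕ × List ι × List ι) =>
          return decide (size ≤ 4 * x.1 ∧ 4 * x.1 ≤ 3 * size ∧
            size ≤ 4 * (rest - x.1) ∧ 4 * (rest - x.1) ≤ 3 * size)) ways
        return r.map (fun x => (S, x.2.1, x.2.2))) none candidates

/-! ## The recursive algorithm -/

/-- The vertex set of each blob in `V`. -/
def blobsT {α ι : Type} [DecidableEq ι] (β : α → ι) (V : List ι) (X : List α) :
    Timed (List (List α)) :=
  mapT (fun b => filterT (fun x => return decide (β x = b)) X) V

/-- The edges created from the band `B`. -/
def bandEdgesT {α ι : Type} [DecidableEq ι] (β : α → ι) (E : List (WEdge α)) (B : ι × ι) :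
    Timed (List (WEdge α)) :=
  filterT (fun e =>
    return decide ((β e.u = B.1 ∧ β e.v = B.2) ∨ (β e.u = B.2 ∧ β e.v = B.1))) E

/-- All sets of edges from the given bands with at most `r` edges from each of them. -/
def selectionsT {α ι : Type} [DecidableEq ι] (β : α → ι) (E : List (WEdge α)) (r : ℕ)
    (bands : List (ι × ι)) : Timed (List (List (WEdge α))) :=
  foldT (fun sets B => do
    let EB ← bandEdgesT β E B
    let subs ← subsetsT EB r
    let l ← mapT (fun s => mapT (fun t => appendT t s) subs) sets
    flattenT l) [[]] bands

/-- The edges of `E` within a single blob. -/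
def blobEdgesT {α ι : Type} [DecidableEq ι] (β : α → ι) (E : List (WEdge α)) :
    Timed (List (WEdge α)) :=
  filterT (fun e => return decide (β e.u = β e.v)) E

/-- The pairs in `E` with both ends in `V`. -/
def inducedBandsT {ι : Type} [DecidableEq ι] (V : List ι) (E : List (ι × ι)) :
    Timed (List (ι × ι)) :=
  filterT (fun e => do
    let a ← elemT e.1 V
    let b ← elemT e.2 V
    return a && b) E

/-- Whether no two edges of `M` share an end. -/
def isMatchingT {α : Type} [DecidableEq α] : List (WEdge α) → Timed Bool
  | [] => do tick; return true
  | e :: M => do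
    tick
    let a ← touchesT M e.u
    let b ← touchesT M e.v
    if a || b then return false else isMatchingT M

/-- Whether the edge set `M` extends to a perfect matching of the graph `(V, E)`. -/
def extendsT {α : Type} [DecidableEq α] (V : List α) (E M : List (WEdge α)) : Timed Bool := do
  if ← isMatchingT M then
    let V₁ ← untouchedT V M
    let E₁ ← inducedT V₁ E
    let r ← perfectMatchingT V₁ E₁
    return r.isSome
  else return false

/-- The recursive algorithm for top-k perfect matching in blow-ups of prototypes of bandwidth `φ`. The
current prototype has blobs `PV` and bands `PE`, the current graph has vertices `GV` and edges
`GE`, the vertex `x` lies in the blob `β x`, and `T` are the tight bands. The value `none` says that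
no perfect matching was found, and `C` is the constant number of blobs up to which the algorithm for
bounded neighbourhood diversity is called. The last number before `k` bounds the depth of the
recursion; as the number of blobs drops in every recursive call, it is never reached if it exceeds
the number of blobs. -/
def bbbT {α ι : Type} [DecidableEq α] [DecidableEq ι] (C φ n : ℕ) (β : α → ι) :
    ℕ → ℕ → List ι → List (ι × ι) → List α → List (WEdge α) → List (ι × ι) →
      Timed (Option (List (WEdge α)))
  | 0, _, _, _, _, _, _ => do tick; return none
  | depth + 1, k, PV, PE, GV, GE, T => do
    tick
    match ← perfectMatchingT GV GE with
    | none => return none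
    | some _ =>
      let blobs ← lengthT PV
      let tight ← lengthT T
      if ⌊((blobs : ℚ) / 2 - 3) / (φ : ℚ)⌋ ≤ 2 * (tight : ℤ) ∨ blobs ≤ C then
        let types ← blobsT β PV GV
        basicT k types GE
      else
        match ← looseSeparatorT φ PV PE T with
        | none => return none
        | some (S, P₁, P₂) =>
          let bands ← filterT (fun B => do
            let a ← elemT B.1 S
            let b ← elemT B.2 S
            return a || b) PE
          let r ← sqrtT n
          let selections ← selectionsT β GE r bands
          let quadruples ← tuplesT 4 k
          let VS ← filterT (fun x => elemT (β x) S) GV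
          let PE₁ ← inducedBandsT P₁ PE
          let PE₂ ← inducedBandsT P₂ PE
          let T₁ ← inducedBandsT P₁ T
          let T₂ ← inducedBandsT P₂ T
          foldT (fun best₀ E' => foldT (fun best q => do
            match q with
            | [_, kblobs, k₁, k₂] =>
              let free ← untouchedT GV E'
              let V₁ ← filterT (fun x => elemT (β x) P₁) free
              let V₂ ← filterT (fun x => elemT (β x) P₂) free
              let E₁ ← inducedT V₁ GE
              let E₂ ← inducedT V₂ GE
              let R₁ ← bbbT C φ n β depth k₁ P₁ PE₁ V₁ E₁ T₁
              let R₂ ← bbbT C φ n β depth k₂ P₂ PE₂ V₂ E₂ T₂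
              match R₁, R₂ with
              | some M₁, some M₂ =>
                let M₁₂ ← appendT M₁ M₂
                let M' ← appendT E' M₁₂
                if ← extendsT GV GE M' then
                  let VB ← untouchedT VS E'
                  let typesB ← blobsT β S VB
                  let EB₀ ← inducedT VB GE
                  let EB ← blobEdgesT β EB₀
                  match ← basicT kblobs typesB EB with
                  | none => return best
                  | some MB =>
                    let M'' ← appendT M' MB
                    if ← betterT k M'' best then return some M'' else return best
                else return best
              | _, _ => return best
            | _ => return best) best₀ quadruples) none selections

/-! ## Blow-ups and bandwidth -/

/-- The bandwidth of a finite graph: the least `b` such that in some linear ordering of the vertices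
the positions of any two adjacent vertices differ by at most `b`. -/
noncomputable def bandwidth {V : Type} [Fintype V] (G : SimpleGraph V) : ℕ :=
  sInf {b : ℕ | ∃ σ : V ≃ Fin (Fintype.card V), ∀ u v, G.Adj u v →
    |((σ u : ℕ) : ℤ) - ((σ v : ℕ) : ℤ)| ≤ b}

/-- An edge-weighted graph on `N` vertices that is a blow-up of a prototype with `m` blobs. -/
structure BlowUp (m N : ℕ) where
  prototype : SimpleGraph (Fin m)
  decAdj : DecidableRel prototype.Adj
  /-- the blob containing a given vertex -/
  blob : Fin N → Fin m
  /-- every blob is replaced by at least one vertex -/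
  blob_surjective : Function.Surjective blob
  /-- whether a blob is replaced by a complete or by an empty graph -/
  complete : Fin m → Bool
  weight : Sym2 (Fin N) → ℚ

namespace BlowUp

variable {m N : ℕ}

instance (I : BlowUp m N) : DecidableRel I.prototype.Adj := I.decAdj

/-- The blown-up graph. -/
def graph (I : BlowUp m N) : SimpleGraph (Fin N) where
  Adj x y := x ≠ y ∧ ((I.blob x = I.blob y ∧ I.complete (I.blob x) = true) ∨
    I.prototype.Adj (I.blob x) (I.blob y))
  symm := by
    constructor
    rintro x y ⟨h, h₁ | h₁⟩
    · exact ⟨h.symm, Or.inl ⟨h₁.1.symm, h₁.1 ▸ h₁.2⟩⟩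
    · exact ⟨h.symm, Or.inr h₁.symm⟩
  loopless := by
    constructor
    rintro x ⟨h, _⟩
    exact h rfl

instance (I : BlowUp m N) : DecidableRel I.graph.Adj := fun x y =>
  inferInstanceAs (Decidable (x ≠ y ∧ ((I.blob x = I.blob y ∧ I.complete (I.blob x) = true) ∨
    I.prototype.Adj (I.blob x) (I.blob y))))

/-- The list of all pairs `(i, j)` with `i < j`. -/
def pairs (N : ℕ) : List (Fin N × Fin N) :=
  (List.finRange N).flatMap fun i =>
    ((List.finRange N).filter fun j => i < j).map fun j => (i, j)

/-- The list of the bands of the prototype. -/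
def bandList (I : BlowUp m N) : List (Fin m × Fin m) :=
  (pairs m).filter fun p => I.prototype.Adj p.1 p.2

/-- The list of the weighted edges of the blown-up graph. -/
def edgeList (I : BlowUp m N) : List (WEdge (Fin N)) :=
  ((pairs N).filter fun p => I.graph.Adj p.1 p.2).map fun p => ⟨p.1, p.2, I.weight s(p.1, p.2)⟩

/-- The recursive algorithm with base case constant `C`, run on the blow-up `I` with its `N / 2 = n`
matching edges, the set `T` of tight bands and the parameters `k` and `φ`. -/
def recursiveAlgorithm (I : BlowUp m N) (C n k φ : ℕ) (T : Finset (Sym2 (Fin m))) :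
    Timed (Option (List (WEdge (Fin N)))) :=
  bbbT C φ n I.blob (m + 1) k (List.finRange m) I.bandList (List.finRange N) I.edgeList
    (I.bandList.filter fun p => s(p.1, p.2) ∈ T)

end BlowUp

end TkPM

/-!
The running time is bounded by an abstract cost analysis: `Timed.Meets x t P` says that `x` takes at
most `t` steps and returns a value with property `P`. The properties needed are bounds on the lengths
of lists, hardly ever the correctness of an algorithm.

*Polynomial parts.* For a size parameter `N ≥ 4`, a step of cost `N ^ q` followed by steps of total
cost `N ^ p` with `q ≤ p` costs at most `N ^ (p + 1)`, and a loop of at most `N` rounds of cost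
`N ^ p` costs at most `N ^ (p + 2)`. Hence a routine is analysed by peeling its steps off a budget
`N ^ e`; the numerals `e` are generous and have no other meaning. Where lists grow, as the family of
blossoms and the edge sets of matchings do, the total growth is polynomial because the number
of rounds is explicitly bounded in the code, and the size parameter is replaced by a power of it.

*Superpolynomial parts.* The only sources are the tuples of the algorithm for bounded neighbourhood
diversity (`tuplesT_meets`), the candidate separators (`subsetsT_meets`) and the selections of edges
(`selectionsT_meets`). Let `W` be polynomial in `n` and bound all sizes. A call in the base case has
`γ = O(φ √n)` blobs (`blobs_le_of_floor_le`), so there are at most `W ^ γ` tuples. There are at most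
`W ^ φ` candidates. A blob of a prototype of bandwidth `φ` has at most `2 φ + 1` bands
(`BlowUp.length_bands_at_le`), so `O(φ ^ 2)` bands touch a separator, and there are
`W ^ O(φ ^ 2 √n)` selections. So each of these numbers is at most `X = W ^ D` with `D = O(φ ^ 2 √n)`,
and since the analysis of all routines is uniform in the size parameter, it applies with `X` instead
of `N`.

*Recursion.* Both sides of a separator have at most three quarters of the blobs, because
`componentsT` and `splitsT` account for every vertex exactly once. Hence the recursion has
depth `O(log n)`, and as every level contributes a factor `X ^ O(1)` (`bbbT_meets`), the total cost is
`X ^ O(log n) = 2 ^ O(φ ^ 2 √n log ^ 2 n)`. For `φ = o(n ^ (1 / 4) / log n)` the exponent is `o(n)`.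
-/

set_option exponentiation.threshold 100000

/-! ### Rules for the cost of timed computations -/

namespace Timed

variable {α β : Type}

/-- `x` takes at most `t` steps and its result satisfies `P`. -/
def Meets (x : Timed α) (t : ℕ) (P : α → Prop) : Prop :=
  x.time ≤ t ∧ P x.val

theorem Meets.mono {x : Timed α} {s t : ℕ} {P Q : α → Prop} (h : Meets x s P) (hst : s ≤ t)
    (hPQ : ∀ a, P a → Q a) : Meets x t Q :=
  ⟨h.1.trans hst, hPQ _ h.2⟩

theorem Meets.pure {a : α} {t : ℕ} {Q : α → Prop} (h : Q a) :
    Meets (Pure.pure a) t Q :=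
  ⟨Nat.zero_le _, h⟩

theorem Meets.pure_true {a : α} {t : ℕ} : Meets (Pure.pure a) t fun _ => True :=
  Meets.pure trivial

theorem Meets.bind {x : Timed α} {f : α → Timed β} {s t : ℕ} {P : α → Prop} {Q : β → Prop}
    (hx : Meets x s P) (hf : ∀ a, P a → Meets (f a) t Q) : Meets (x >>= f) (s + t) Q :=
  ⟨Nat.add_le_add hx.1 (hf _ hx.2).1, (hf _ hx.2).2⟩

theorem Meets.tick_bind {f : Unit → Timed β} {t : ℕ} {Q : β → Prop}
    (hf : Meets (f ()) t Q) : Meets (tick >>= f) (t + 1) Q := by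
  rw [add_comm]
  exact Meets.bind (P := fun _ => True) ⟨le_rfl, trivial⟩ fun _ _ => hf

theorem Meets.tick_pure {a : α} {t : ℕ} {Q : α → Prop} (ht : 0 < t) (h : Q a) :
    Meets (tick >>= fun _ => Pure.pure a) t Q :=
  ⟨ht, h⟩

/-! ### Budgets that are powers of a size parameter -/

variable {N : ℕ}

theorem pow_add_pow_le (hN : 4 ≤ N) {p q : ℕ} (h : q ≤ p) : N ^ q + N ^ p ≤ N ^ (p + 1) := by
  have h1 : N ^ q ≤ N ^ p := Nat.pow_le_pow_right (by omega) h
  rw [pow_succ]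
  nlinarith [Nat.zero_le (N ^ p)]

theorem one_le_pow_of_four_le (hN : 4 ≤ N) (p : ℕ) : 1 ≤ N ^ p := Nat.one_le_pow _ _ (by omega)

theorem four_le_pow (hN : 4 ≤ N) {p : ℕ} (hp : p ≠ 0) : 4 ≤ N ^ p :=
  hN.trans (Nat.le_self_pow hp N)

/-- A loop of at most `N` rounds, each within the budget `N ^ p`, is within the budget
`N ^ (p + 2)`. -/
theorem loop_le_pow (hN : 4 ≤ N) {l : ℕ} (hl : l ≤ N) (p : ℕ) :
    l * (N ^ p + 1) + 1 ≤ N ^ (p + 2) := by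
  have h1 := one_le_pow_of_four_le hN p
  have h2 : l * (N ^ p + 1) ≤ N * (N ^ p + 1) := Nat.mul_le_mul_right _ hl
  have h3 : N ^ (p + 2) = N * N ^ p * N := by ring
  rw [h3]
  nlinarith [Nat.mul_le_mul_left N h1]

theorem Meets.mono_pow {x : Timed α} {p q : ℕ} {P Q : α → Prop} (hN : 4 ≤ N)
    (h : Meets x (N ^ q) P) (hPQ : ∀ a, P a → Q a) (hqp : q ≤ p := by omega) :
    Meets x (N ^ p) Q :=
  h.mono (Nat.pow_le_pow_right (by omega) hqp) hPQ

/-- Change of the size parameter from `N ^ a` to `N`. -/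
theorem Meets.of_pow {x : Timed α} (a p : ℕ) {P : α → Prop} (h : Meets x ((N ^ a) ^ p) P) :
    Meets x (N ^ (a * p)) P := by
  rwa [_root_.pow_mul]

theorem Meets.pow_mul {x : Timed α} (a p : ℕ) {q : ℕ} {P : α → Prop}
    (h : Meets x ((N ^ a) ^ p) P) (hq : a * p = q := by norm_num) : Meets x (N ^ q) P :=
  hq ▸ h.of_pow a p

/-- The rule for a sequence of steps: every step lowers the exponent of the budget by one. -/
theorem Meets.bindP (hN : 4 ≤ N) {x : Timed α} {f : α → Timed β} {p q : ℕ} {P : α → Prop}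
    {Q : β → Prop} (hx : Meets x (N ^ q) P) (hf : ∀ a, P a → Meets (f a) (N ^ p) Q)
    (hqp : q ≤ p := by omega) : Meets (x >>= f) (N ^ (p + 1)) Q :=
  (hx.bind hf).mono (pow_add_pow_le hN hqp) fun _ h => h

/-- The rule for a sequence of steps that ends with a recursive call of cost `t`. -/
theorem Meets.bindT (hN : 4 ≤ N) {x : Timed α} {f : α → Timed β} {p q t : ℕ} {P : α → Prop}
    {Q : β → Prop} (hx : Meets x (N ^ q) P) (hf : ∀ a, P a → Meets (f a) (N ^ p + t) Q)
    (hqp : q ≤ p := by omega) : Meets (x >>= f) (N ^ (p + 1) + t) Q :=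
  (hx.bind hf).mono (by rw [← add_assoc]; exact Nat.add_le_add_right (pow_add_pow_le hN hqp) t)
    fun _ h => h

theorem Meets.tickP (hN : 4 ≤ N) {f : Unit → Timed β} {p : ℕ} {Q : β → Prop}
    (hf : Meets (f ()) (N ^ p) Q) : Meets (tick >>= f) (N ^ (p + 1)) Q :=
  (Meets.tick_bind hf).mono
    (by have := pow_add_pow_le hN (Nat.zero_le p); rw [pow_zero] at this; omega) fun _ h => h

theorem Meets.tickT (hN : 4 ≤ N) {f : Unit → Timed β} {p t : ℕ} {Q : β → Prop}
    (hf : Meets (f ()) (N ^ p + t) Q) : Meets (tick >>= f) (N ^ (p + 1) + t) Q :=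
  (Meets.tick_bind hf).mono
    (by have := pow_add_pow_le hN (Nat.zero_le p); rw [pow_zero] at this; omega) fun _ h => h

/-- The last call of a sequence of steps, when it is the recursive one. -/
theorem Meets.tail {x : Timed α} {s t : ℕ} {Q : α → Prop} (h : Meets x t Q) :
    Meets x (s + t) Q :=
  h.mono (Nat.le_add_left _ _) fun _ h => h

/-- One round of a recursion with `r + 1` rounds left, when every round has the budget `T`. -/
theorem Meets.round {x : Timed α} {T r : ℕ} {Q : α → Prop} (h : Meets x (T + r * T) Q) :
    Meets x ((r + 1) * T) Q :=
  h.mono (by rw [add_mul, one_mul, add_comm]) fun _ h => h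

theorem Meets.rounds {x : Timed α} {p r : ℕ} {Q : α → Prop} (hr : r ≤ N)
    (h : Meets x (r * N ^ p) Q) : Meets x (N ^ (p + 1)) Q :=
  h.mono (by rw [pow_succ']; exact Nat.mul_le_mul_right _ hr) fun _ h => h

theorem Meets.ite {c : Prop} [Decidable c] {x y : Timed α} {t : ℕ} {Q : α → Prop}
    (hx : c → Meets x t Q) (hy : ¬c → Meets y t Q) : Meets (if c then x else y) t Q := by
  split <;> simp_all

end Timed

namespace TkPM

open Timed

/-! ### Loops over lists -/

section Loops

variable {α β : Type} {N p : ℕ}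

/-- The cost of `mapT` without reference to a size parameter, for bodies whose cost is
not a power of it. -/
theorem mapT_meets_add {f : α → Timed β} {t : ℕ} {Q : β → Prop} : ∀ {l : List α},
    (∀ a ∈ l, Meets (f a) t Q) →
    Meets (mapT f l) (l.length * (t + 1) + 1) fun r => r.length = l.length ∧ ∀ b ∈ r, Q b
  | [], _ => by
    rw [mapT]
    exact Meets.tick_pure (by simp) (by simp)
  | a :: l, h => by
    rw [mapT]
    have hb : Meets (f a) t Q := h a (by simp)
    have hr := mapT_meets_add (l := l) fun b hb => h b (List.mem_cons_of_mem _ hb)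
    refine (Meets.tick_bind (hb.bind fun b hQ => hr.bind (t := 0) fun bs hbs =>
      Meets.pure ?_)).mono ?_ fun _ h => h
    · exact ⟨by simp [hbs.1], by simpa using ⟨hQ, hbs.2⟩⟩
    · simp only [List.length_cons]; linarith

theorem mapT_meets (hN : 4 ≤ N) {f : α → Timed β} {Q : β → Prop} {l : List α}
    (hl : l.length ≤ N) (h : ∀ a ∈ l, Meets (f a) (N ^ p) Q) :
    Meets (mapT f l) (N ^ (p + 2)) fun r => r.length = l.length ∧ ∀ b ∈ r, Q b :=
  (mapT_meets_add h).mono (loop_le_pow hN hl p) fun _ h => h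

theorem filterMapT_meets (hN : 4 ≤ N) {f : α → Timed (Option β)} {Q : β → Prop} {l : List α}
    (hl : l.length ≤ N) (h : ∀ a ∈ l, Meets (f a) (N ^ p) fun o => ∀ c, o = some c → Q c) :
    Meets (filterMapT f l) (N ^ (p + 2)) fun r => r.length ≤ l.length ∧ ∀ b ∈ r, Q b := by
  suffices H : Meets (filterMapT f l) (l.length * (N ^ p + 1) + 1)
      fun r => r.length ≤ l.length ∧ ∀ b ∈ r, Q b from
    H.mono (loop_le_pow hN hl p) fun _ h => h
  clear hl
  induction l with
  | nil => rw [filterMapT]; exact Meets.tick_pure (by simp) (by simp)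
  | cons a l ih =>
    rw [filterMapT]
    have hr := ih fun b hb => h b (List.mem_cons_of_mem _ hb)
    refine (Meets.tick_bind ((h a (by simp)).bind fun o ho => hr.bind (t := 0) fun bs hbs =>
      Meets.pure ?_)).mono ?_ fun _ h => h
    · cases o with
      | none => exact ⟨hbs.1.trans (by simp), hbs.2⟩
      | some c => exact ⟨by simpa using hbs.1, by simpa using ⟨ho c rfl, hbs.2⟩⟩
    · simp only [List.length_cons]; linarith

/-- The value of the test is recorded exactly, so that a list and the complementary selection are
known to split it. -/
theorem filterT_meets (hN : 4 ≤ N) {f : α → Timed Bool} {l : List α} {P : α → Bool → Prop}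
    (hl : l.length ≤ N) (h : ∀ a ∈ l, Meets (f a) (N ^ p) (P a)) :
    Meets (filterT f l) (N ^ (p + 2)) fun r => r = l.filter fun a => (f a).val := by
  suffices H : Meets (filterT f l) (l.length * (N ^ p + 1) + 1)
      fun r => r = l.filter fun a => (f a).val from H.mono (loop_le_pow hN hl p) fun _ h => h
  clear hl
  induction l with
  | nil => rw [filterT]; exact Meets.tick_pure (by simp) (by simp)
  | cons a l ih =>
    rw [filterT]
    have hr := ih fun b hb => h b (List.mem_cons_of_mem _ hb)
    have ha : Meets (f a) (N ^ p) fun b => b = (f a).val := ⟨(h a (by simp)).1, rfl⟩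
    refine (Meets.tick_bind (ha.bind fun b hb => hr.bind (t := 0) fun bs hbs =>
      Meets.pure ?_)).mono ?_ fun _ h => h
    · subst hb hbs
      rw [List.filter_cons]
    · simp only [List.length_cons]; linarith

theorem filterT_meets_length (hN : 4 ≤ N) {f : α → Timed Bool} {l : List α}
    {P : α → Bool → Prop} (hl : l.length ≤ N) (h : ∀ a ∈ l, Meets (f a) (N ^ p) (P a)) :
    Meets (filterT f l) (N ^ (p + 2)) fun r => r.length ≤ l.length ∧ ∀ a ∈ r, a ∈ l :=
  (filterT_meets hN hl h).mono le_rfl fun r hr => by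
    subst hr
    exact ⟨List.length_filter_le _ _, fun a ha => List.mem_of_mem_filter ha⟩

theorem findT_meets (hN : 4 ≤ N) {f : α → Timed Bool} {l : List α} {P : α → Bool → Prop}
    (hl : l.length ≤ N) (h : ∀ a ∈ l, Meets (f a) (N ^ p) (P a)) :
    Meets (findT f l) (N ^ (p + 2)) fun o => ∀ a, o = some a → a ∈ l ∧ P a true := by
  suffices H : Meets (findT f l) (l.length * (N ^ p + 1) + 1)
      fun o => ∀ a, o = some a → a ∈ l ∧ P a true from
    H.mono (loop_le_pow hN hl p) fun _ h => h
  clear hl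
  induction l with
  | nil => rw [findT]; exact Meets.tick_pure (by simp) (by simp)
  | cons a l ih =>
    rw [findT]
    have hr := ih fun b hb => h b (List.mem_cons_of_mem _ hb)
    refine (Meets.tick_bind ((h a (by simp)).bind (t := l.length * (N ^ p + 1) + 1)
      fun b hb => ?_)).mono ?_ fun _ h => h
    · cases b with
      | true => exact Meets.pure fun c hc => by simp_all
      | false => exact hr.mono le_rfl fun o ho c hc =>
          ⟨List.mem_cons_of_mem _ (ho c hc).1, (ho c hc).2⟩
    · simp only [List.length_cons]; linarith

theorem anyT_meets (hN : 4 ≤ N) {f : α → Timed Bool} {l : List α} {P : α → Bool → Prop}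
    (hl : l.length ≤ N) (h : ∀ a ∈ l, Meets (f a) (N ^ p) (P a)) :
    Meets (anyT f l) (N ^ (p + 3)) fun _ => True :=
  (findT_meets hN hl h).bindP hN fun _ _ => Meets.pure_true

theorem elemT_meets (hN : 4 ≤ N) [DecidableEq α] {a : α} {l : List α} (hl : l.length ≤ N) :
    Meets (elemT a l) (N ^ 3) fun _ => True :=
  anyT_meets (p := 0) hN hl fun _ _ => Meets.pure_true

theorem anyT_pure_val (p : α → Bool) (l : List α) :
    (anyT (fun a => pure (p a)) l).val = l.any p := by
  suffices H : (findT (fun a => pure (p a)) l).val.isSome = l.any p from H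
  induction l with
  | nil => rw [findT]; rfl
  | cons a l ih =>
    rw [findT, List.any_cons, ← ih]
    change (if p a = true then (pure (some a) : Timed (Option α))
      else findT (fun a => pure (p a)) l).val.isSome = _
    cases p a <;> rfl

theorem elemT_val [DecidableEq α] (a : α) (l : List α) : (elemT a l).val = decide (a ∈ l) := by
  rw [elemT, anyT_pure_val, List.any_eq]
  simp

/-- The invariant of a loop may refer to the part of the list that has been processed. -/
theorem foldT_meets_prefix (hN : 4 ≤ N) {f : β → α → Timed β} (Inv : List α → β → Prop)
    {l : List α} {b : β} (hl : l.length ≤ N) (h0 : Inv [] b)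
    (h : ∀ pre a post b, l = pre ++ a :: post → Inv pre b →
      Meets (f b a) (N ^ p) (Inv (pre ++ [a]))) :
    Meets (foldT f b l) (N ^ (p + 2)) (Inv l) := by
  suffices H : ∀ (post pre : List α) (b : β), l = pre ++ post → Inv pre b →
      Meets (foldT f b post) (post.length * (N ^ p + 1) + 1) (Inv l) from
    (H l [] b rfl h0).mono (loop_le_pow hN hl p) fun _ h => h
  intro post
  induction post with
  | nil =>
    intro pre b hpre hb
    rw [foldT]
    exact Meets.tick_pure (by simp) (by simpa [hpre] using hb)
  | cons a post ih =>
    intro pre b hpre hb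
    rw [foldT]
    refine (Meets.tick_bind ((h pre a post b hpre hb).bind fun c hc =>
      ih (pre ++ [a]) c (by simp [hpre]) hc)).mono ?_ fun _ h => h
    simp only [List.length_cons]; linarith

/-- The invariant of a loop may refer to the number of elements that have been processed. -/
theorem foldT_meets (hN : 4 ≤ N) {f : β → α → Timed β} (Inv : ℕ → β → Prop)
    {l : List α} {b : β} (hl : l.length ≤ N) (h0 : Inv 0 b)
    (h : ∀ i a b, i < l.length → a ∈ l → Inv i b → Meets (f b a) (N ^ p) (Inv (i + 1))) :
    Meets (foldT f b l) (N ^ (p + 2)) (Inv l.length) := by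
  refine foldT_meets_prefix hN (fun pre b => Inv pre.length b) hl h0 ?_
  intro pre a post b hpre hb
  simpa using h pre.length a b (by simp [hpre]) (by simp [hpre]) hb

theorem appendT_meets_add : ∀ l r : List α,
    Meets (appendT l r) (l.length + 1) fun s => s = l ++ r
  | [], r => by
    rw [appendT]
    exact Meets.tick_pure (by simp) (by simp)
  | a :: l, r => by
    rw [appendT]
    exact Meets.tick_bind ((appendT_meets_add l r).bind (t := 0) fun s hs =>
      Meets.pure (by simp [hs]))

theorem appendT_meets (hN : 4 ≤ N) {l r : List α} (hl : l.length ≤ N) :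
    Meets (appendT l r) (N ^ 2) fun s => s = l ++ r :=
  (appendT_meets_add l r).mono (by nlinarith) fun _ h => h

theorem flattenT_meets (hN : 4 ≤ N) {l : List (List α)} (hl : l.length ≤ N)
    (h : ∀ a ∈ l, a.length ≤ N) : Meets (flattenT l) (N ^ 4) fun s => s = l.flatten := by
  have H : Meets (flattenT l) (l.length * (N ^ 2 + 1) + 1) fun s => s = l.flatten := by
    clear hl
    induction l with
    | nil => rw [flattenT]; exact Meets.tick_pure (by simp) (by simp)
    | cons a l ih =>
      rw [flattenT]
      refine (Meets.tick_bind ((ih fun b hb => h b (List.mem_cons_of_mem _ hb)).bind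
        fun s hs => (appendT_meets hN (h a (by simp))).mono le_rfl fun r hr => ?_)).mono
        ?_ fun _ h => h
      · simp [hr, hs]
      · simp only [List.length_cons]; linarith
  exact H.mono (loop_le_pow hN hl 2) fun _ h => h

theorem length_flatten_le {l : List (List α)} {a b : ℕ} (hl : l.length ≤ a)
    (h : ∀ x ∈ l, x.length ≤ b) : l.flatten.length ≤ a * b := by
  rw [List.length_flatten]
  calc (l.map List.length).sum ≤ (l.map List.length).length • b :=
        List.sum_le_card_nsmul _ _ (by simpa using h)
    _ ≤ a * b := by simpa using Nat.mul_le_mul_right b hl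

theorem lengthT_meets (hN : 4 ≤ N) {l : List α} (hl : l.length ≤ N) :
    Meets (lengthT l) (N ^ 2) fun s => s = l.length :=
  foldT_meets (p := 0) hN (fun i s => s = i) hl rfl fun i a b _ _ h =>
    Meets.pure (by rw [h])

theorem reverseT_meets (hN : 4 ≤ N) {l : List α} (hl : l.length ≤ N) :
    Meets (reverseT l) (N ^ 2) fun s => s = l.reverse :=
  foldT_meets_prefix (p := 0) hN (fun pre s => s = pre.reverse) hl rfl
    fun pre a post b _ h => Meets.pure (by simp [h])

theorem rangeFromT_meets (hN : 4 ≤ N) {a j : ℕ} (hj : j ≤ N) :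
    Meets (rangeFromT a j) (N ^ 2) fun s => s.length = j ∧ ∀ x ∈ s, x < a + j := by
  have H : ∀ a, Meets (rangeFromT a j) (j * (N ^ 0 + 1) + 1)
      fun s => s.length = j ∧ ∀ x ∈ s, x < a + j := by
    clear hj
    induction j with
    | zero =>
      intro a
      rw [rangeFromT]
      exact Meets.tick_pure (by simp) (by simp)
    | succ j ih =>
      intro a
      rw [rangeFromT]
      refine (Meets.tick_bind ((ih (a + 1)).bind (t := 0) fun s hs =>
        Meets.pure ⟨by simp [hs.1], fun x hx => ?_⟩)).mono (by linarith) fun _ h => h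
      · rcases List.mem_cons.1 hx with rfl | hx
        · omega
        · have := hs.2 x hx
          omega
  exact (H a).mono (loop_le_pow hN hj 0) fun _ h => h

theorem sqrtT_meets (hN : 4 ≤ N) {n : ℕ} (hn : n + 1 ≤ N) :
    Meets (sqrtT n) (N ^ 3) fun s => s ≤ Nat.sqrt n :=
  (rangeFromT_meets hN hn).bindP hN fun l hl =>
    (foldT_meets (p := 0) hN (fun _ s => s ≤ Nat.sqrt n) (hl.1.le.trans hn) (Nat.zero_le _)
      fun i a b _ _ h => Meets.pure (by
        split
        · rwa [Nat.le_sqrt]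
        · exact h))

end Loops

/-! ### Sublists, tuples and connected components -/

section Enumeration

variable {α : Type} {N : ℕ}

theorem pow_succ_add_pow_le (a r : ℕ) : a ^ (r + 1) + a ^ r ≤ (a + 1) ^ (r + 1) := by
  calc a ^ (r + 1) + a ^ r = a ^ r * (a + 1) := by ring
    _ ≤ (a + 1) ^ r * (a + 1) :=
        Nat.mul_le_mul_right _ (Nat.pow_le_pow_left (Nat.le_succ a) r)
    _ = (a + 1) ^ (r + 1) := by ring

/-- The bounds follow the recursion of the binomial sums `∑ i ≤ r, l.length.choose i`. -/
theorem subsetsT_meets_add : ∀ (l : List α) (r : ℕ),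
    Meets (subsetsT l r) (3 * (l.length + 1) * (l.length + 1) ^ r)
      fun s => s.length ≤ (l.length + 1) ^ r ∧ ∀ x ∈ s, x.length ≤ r
  | [], r => by
    rw [subsetsT]
    exact Meets.tick_pure (by simp) (by simp)
  | a :: l, 0 => by
    rw [subsetsT]
    exact Meets.tick_pure (by simp) (by simp)
  | a :: l, r + 1 => by
    rw [subsetsT]
    have hmap : ∀ s : List (List α), s.length ≤ (l.length + 1) ^ r → (∀ x ∈ s, x.length ≤ r) →
        Meets (mapT (fun t => pure (a :: t)) s) ((l.length + 1) ^ r + 1)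
          fun u => u.length ≤ (l.length + 1) ^ r ∧ ∀ x ∈ u, x.length ≤ r + 1 := fun s hs hx =>
      (mapT_meets_add (t := 0) (Q := fun x : List α => x.length ≤ r + 1) fun t ht =>
        Meets.pure (by simpa using hx t ht)).mono (by simpa using hs)
        fun u hu => ⟨hu.1.le.trans hs, hu.2⟩
    have happ : ∀ s t : List (List α), s.length ≤ (l.length + 1) ^ (r + 1) →
        Meets (appendT s t) ((l.length + 1) ^ (r + 1) + 1) fun u => u = s ++ t := fun s t hs =>
      (appendT_meets_add s t).mono (by omega) fun _ h => h
    refine (Meets.tick_bind ((subsetsT_meets_add l (r + 1)).bind fun s hs =>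
      (subsetsT_meets_add l r).bind fun t ht => (hmap t ht.1 ht.2).bind fun u hu =>
      (happ s u hs.1).mono le_rfl fun v hv => ?_)).mono ?_ fun _ h => h
    · subst hv
      refine ⟨?_, fun x hx => ?_⟩
      · simp only [List.length_append, List.length_cons]
        have := pow_succ_add_pow_le (l.length + 1) r
        omega
      · rcases List.mem_append.1 hx with h | h
        · exact hs.2 x h
        · exact hu.2 x h
    · simp only [List.length_cons]
      generalize ha : l.length + 1 = A
      have h1 := pow_succ_add_pow_le A r
      have h2 : 1 ≤ A ^ r := Nat.one_le_pow _ _ (by omega)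
      have h3 : 1 ≤ A ^ (r + 1) := Nat.one_le_pow _ _ (by omega)
      have h4 : 3 * (A + 1) * (A ^ (r + 1) + A ^ r) ≤ 3 * (A + 1) * (A + 1) ^ (r + 1) :=
        Nat.mul_le_mul_left _ h1
      refine le_trans ?_ h4
      have : 3 * (A + 1) * (A ^ (r + 1) + A ^ r) = 3 * A * A ^ (r + 1) + 3 * A * A ^ r
        + 3 * A ^ (r + 1) + 3 * A ^ r := by ring
      omega

theorem subsetsT_meets (hN : 4 ≤ N) {l : List α} {r : ℕ} (hl : l.length + 1 ≤ N)
    (hr : (l.length + 1) ^ r ≤ N) :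
    Meets (subsetsT l r) (N ^ 3)
      fun s => s.length ≤ (l.length + 1) ^ r ∧ ∀ x ∈ s, x.length ≤ r := by
  refine (subsetsT_meets_add l r).mono ?_ fun _ h => h
  calc 3 * (l.length + 1) * (l.length + 1) ^ r ≤ N * N * N := by gcongr; omega
    _ = N ^ 3 := by ring

/-- The number `U` bounds all sums `s + 1` that occur in the recursion. -/
theorem tuplesT_meets_aux (hN : 4 ≤ N) {U : ℕ} (hU : 1 ≤ U) (hUN : U ≤ N) : ∀ (g s : ℕ),
    U ^ g ≤ N → s + 1 ≤ U →
    Meets (tuplesT g s) ((g + 1) * (U ^ g * N ^ 5))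
      fun l => l.length ≤ U ^ g ∧ ∀ c ∈ l, ∀ x ∈ c, x ≤ s
  | 0, 0, _, _ => by
    rw [tuplesT]
    exact Meets.tick_pure (by positivity) (by simp)
  | 0, s + 1, _, _ => by
    rw [tuplesT]
    exact Meets.tick_pure (by positivity) (by simp)
  | g + 1, s, hg, hs => by
    rw [tuplesT]
    have hg' : U ^ g ≤ N := (Nat.pow_le_pow_right hU (Nat.le_succ g)).trans hg
    have hbody : ∀ j, j ≤ s → Meets (do
        let rests ← tuplesT g (s - j)
        mapT (fun c => pure (j :: c)) rests) ((g + 1) * (U ^ g * N ^ 5) + N ^ 2)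
        fun l => l.length ≤ U ^ g ∧ ∀ c ∈ l, ∀ x ∈ c, x ≤ s := fun j hj =>
      (tuplesT_meets_aux hN hU hUN g (s - j) hg' (by omega)).bind fun rests hrests =>
        (mapT_meets (p := 0) (Q := fun c : List ℕ => ∀ x ∈ c, x ≤ s) hN (hrests.1.trans hg')
          fun c hc => Meets.pure fun x hx => by
            rcases List.mem_cons.1 hx with rfl | hx
            · exact hj
            · exact (hrests.2 c hc x hx).trans (Nat.sub_le _ _)).mono le_rfl
          fun l hl => ⟨hl.1.le.trans hrests.1, hl.2⟩
    refine (Meets.tick_bind ((rangeFromT_meets hN (hs.trans hUN)).bind fun firsts hf =>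
      ((mapT_meets_add (l := firsts) fun j hj => hbody j (by have := hf.2 j hj; omega)).mono
        (by rw [hf.1]) fun _ h => h).bind fun parts hp =>
      (flattenT_meets hN (by omega) fun x hx => (hp.2 x hx).1.trans hg').mono le_rfl
        fun l hl => ?_)).mono ?_ fun _ h => h
    · subst hl
      refine ⟨?_, fun c hc => ?_⟩
      · calc parts.flatten.length ≤ U * U ^ g :=
              length_flatten_le (by omega) fun x hx => (hp.2 x hx).1
          _ = U ^ (g + 1) := by ring
      · obtain ⟨x, hx, hcx⟩ := List.mem_flatten.1 hc
        exact (hp.2 x hx).2 c hcx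
    · have h1 : (s + 1) * ((g + 1) * (U ^ g * N ^ 5) + N ^ 2 + 1) ≤
          U * ((g + 1) * (U ^ g * N ^ 5)) + N * N ^ 2 + N := by
        nlinarith [Nat.mul_le_mul_right ((g + 1) * (U ^ g * N ^ 5) + N ^ 2 + 1) hs,
          Nat.mul_le_mul_right (N ^ 2 + 1) hUN]
      have h2 : N ^ 5 ≤ U ^ (g + 1) * N ^ 5 := Nat.le_mul_of_pos_left _ (by positivity)
      have h3 : 2 + N ^ 2 + N + N * N ^ 2 + N ^ 4 ≤ N ^ 5 := by
        have e3 : N * N ^ 2 = N ^ 3 := by ring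
        have a2 : N + N ^ 2 ≤ N ^ 3 := by simpa using pow_add_pow_le hN (show 1 ≤ 2 by norm_num)
        have a3 : N ^ 3 + N ^ 3 ≤ N ^ 4 := pow_add_pow_le hN le_rfl
        have a4 := one_le_pow_of_four_le hN 4
        have e5 : N ^ 5 = N ^ 4 * N := by ring
        have e4 : 4 * N ^ 4 ≤ N ^ 5 := by rw [e5]; nlinarith [Nat.zero_le (N ^ 4)]
        omega
      have h4 : (g + 1 + 1) * (U ^ (g + 1) * N ^ 5) =
          U * ((g + 1) * (U ^ g * N ^ 5)) + U ^ (g + 1) * N ^ 5 := by ring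
      rw [h4]
      omega

theorem tuplesT_meets (hN : 4 ≤ N) {g s : ℕ} (hg : g + 1 ≤ N) (hs : s + 1 ≤ N)
    (h : (s + 1) ^ g ≤ N) :
    Meets (tuplesT g s) (N ^ 7) fun l => l.length ≤ (s + 1) ^ g ∧ ∀ c ∈ l, ∀ x ∈ c, x ≤ s := by
  refine (tuplesT_meets_aux hN (Nat.succ_pos s) hs g s h le_rfl).mono ?_ fun _ h => h
  calc (g + 1) * ((s + 1) ^ g * N ^ 5) ≤ N * (N * N ^ 5) := by gcongr
    _ = N ^ 7 := by ring

/-- The vertex sets that `componentsT` returns partition the vertex list. -/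
theorem componentsT_meets [DecidableEq α] (hN : 4 ≤ N) {V : List α} {E : List (α × α)}
    (hV : V.length ≤ N) (hE : E.length ≤ N) :
    Meets (componentsT V E) (N ^ 28) fun K =>
      K.flatten.length = V.length ∧ K.length ≤ V.length + E.length := by
  have hA : 4 ≤ N ^ 2 := four_le_pow hN (by norm_num)
  have hVE : V.length + E.length ≤ N ^ 2 := by nlinarith
  refine Meets.pow_mul 2 14 ?_
  rw [componentsT]
  refine Meets.bindP hA (mapT_meets (p := 0) (Q := fun x : List α => x.length = 1) hA
    (by omega) fun _ _ => Meets.pure (by simp)) fun start hstart => ?_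
  have hone : start.flatten.length = V.length := by
    rw [List.length_flatten, ← hstart.1, List.map_congr_left (g := fun _ => 1) hstart.2]
    simp
  refine (foldT_meets (p := 10) hA (fun (i : ℕ) (comps : List (List α)) =>
    comps.flatten.length = V.length ∧ comps.length ≤ V.length + i) (by omega)
    ⟨hone, by omega⟩ fun i e comps hi _ hc => ?_).mono_pow hA fun _ h => h
  have hmem : ∀ K ∈ comps, K.length ≤ N ^ 2 := fun K hK => by
    have : K.length ≤ comps.flatten.length := (List.sublist_flatten_of_mem hK).length_le
    omega
  refine Meets.bindP hA (filterT_meets (p := 5) hA (by omega) fun K hK =>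
    (elemT_meets hA (hmem K hK)).bindP hA fun b _ =>
    (elemT_meets hA (hmem K hK)).bindP hA fun c _ => Meets.pure_true) fun hit hhit => ?_
  refine Meets.bindP hA (filterT_meets (p := 5) hA (by omega) fun K hK =>
    (elemT_meets hA (hmem K hK)).bindP hA fun b _ =>
    (elemT_meets hA (hmem K hK)).bindP hA fun c _ => Meets.pure_true) fun rest hrest => ?_
  -- the two filters have complementary tests, so `hit` and `rest` partition `comps`
  have hperm : (hit ++ rest).Perm comps := by
    subst hhit hrest
    exact List.filter_append_perm _ _
  have hlen := hperm.length_eq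
  have hflat := hperm.flatten.length_eq
  rw [List.length_append] at hlen
  rw [List.flatten_append, List.length_append] at hflat
  refine Meets.bindP hA (flattenT_meets hA (by omega) fun K hK =>
    hmem K (hperm.subset (List.mem_append_left _ hK))) fun K hK => Meets.pure ?_
  subst hK
  refine ⟨?_, ?_⟩
  · rw [List.flatten_cons, List.length_append]; omega
  · rw [List.length_cons]; omega

end Enumeration

/-! ### Maximum matching -/

section Matching

variable {α : Type} [DecidableEq α] {N : ℕ}

theorem neighboursT_meets (hN : 4 ≤ N) {E : List (α × α)} {v : α} (hE : E.length ≤ N) :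
    Meets (neighboursT E v) (N ^ 2) fun r => r.length ≤ E.length :=
  (filterMapT_meets (p := 0) (Q := fun _ => True) hN hE fun _ _ =>
    Meets.pure fun _ _ => trivial).mono le_rfl fun _ h => h.1

theorem coversT_meets (hN : 4 ≤ N) {M : List (α × α)} {v : α} (hM : M.length ≤ N) :
    Meets (coversT M v) (N ^ 3) fun _ => True :=
  anyT_meets (p := 0) hN hM fun _ _ => Meets.pure_true

theorem takeToT_meets (a : α) : ∀ l : List α,
    Meets (takeToT a l) (l.length + 1) fun r => r.length ≤ l.length
  | [] => by
    rw [takeToT]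
    exact Meets.tick_pure (by simp) (by simp)
  | b :: l => by
    rw [takeToT]
    refine Meets.tick_bind (Meets.ite (fun _ => Meets.pure (by simp)) fun _ => ?_)
    exact (takeToT_meets a l).bind (t := 0) fun r hr => Meets.pure (by simpa using hr)

theorem firstCycleT_meets (hN : 4 ≤ N) : ∀ (l past : List α), past.length + l.length ≤ N →
    Meets (firstCycleT past l) ((l.length + 1) * N ^ 5)
      fun o => ∀ B, o = some B → B.length ≤ N
  | [], past, _ => by
    rw [firstCycleT]
    exact Meets.tick_pure (by positivity) (by simp)
  | a :: l, past, h => by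
    rw [firstCycleT]
    simp only [List.length_cons] at h ⊢
    refine Meets.round (Meets.tickT hN (Meets.bindT hN (elemT_meets hN (by omega))
      fun b _ => Meets.ite (fun _ => ?_) fun _ => ?_))
    · refine Meets.mono (t := N ^ 3 + (l.length + 1) * N ^ 5) (Meets.bindT hN (p := 2)
        ((takeToT_meets a past).mono (t := N ^ 2) (by nlinarith) fun _ h => h) fun B hB =>
        Meets.pure ?_) le_rfl fun _ h => h
      rintro _ ⟨rfl⟩
      omega
    · exact (firstCycleT_meets hN l (a :: past) (by simp only [List.length_cons]; omega)).tail

theorem shrinkEdgesT_meets (hN : 4 ≤ N) {B : List α} {c : α} {E : List (α × α)}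
    (hB : B.length ≤ N) (hE : E.length ≤ N) :
    Meets (shrinkEdgesT B c E) (N ^ 8) fun r => r.length ≤ E.length := by
  rw [shrinkEdgesT]
  refine Meets.bindP hN (mapT_meets (p := 5) (Q := fun _ => True) hN hE fun e _ =>
    (elemT_meets hN hB).bindP hN fun _ _ => (elemT_meets hN hB).bindP hN fun _ _ =>
    Meets.pure_true) fun E₁ hE₁ => ?_
  exact (filterT_meets_length (p := 0) hN (hE₁.1.le.trans hE) fun _ _ =>
    Meets.pure_true).mono_pow hN fun r hr => hr.1.trans hE₁.1.le

/-- A round adds at most `|E|` walks to the queue, and its new walks are longer by two than the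
one removed; hence lengths stay polynomial throughout the search. -/
theorem alternatingWalkT_meets (hN : 4 ≤ N) {E M : List (α × α)} {X : List α}
    (hE : E.length ≤ N) (hM : M.length ≤ N) (hX : X.length ≤ N) :
    ∀ (r : ℕ) (queue : List (List α)) (seen : List α),
      queue.length + r * E.length ≤ N → seen.length + r * E.length ≤ N →
      (∀ W ∈ queue, W.length + 2 * r ≤ N) →
      Meets (alternatingWalkT E M X r queue seen) ((r + 1) * N ^ 13)
        fun o => ∀ W, o = some W → W.length ≤ N
  | 0, queue, seen, _, _, _ => by
    rw [alternatingWalkT]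
    exact Meets.tick_pure (by positivity) (by simp)
  | r + 1, [], seen, _, _, _ => by
    rw [alternatingWalkT]
    exact Meets.tick_pure (by positivity) (by simp)
  | r + 1, [] :: queue, seen, _, _, _ => by
    rw [alternatingWalkT]
    exact Meets.tick_pure (by positivity) (by simp)
  | r + 1, (v :: W) :: queue, seen, hq, hs, hW => by
    rw [alternatingWalkT]
    have hvW := hW (v :: W) (by simp)
    simp only [List.length_cons, add_mul, one_mul] at hq hs hvW
    refine Meets.round (Meets.tickT hN (Meets.bindT hN (neighboursT_meets hN hE) fun nb hnb =>
      Meets.bindT hN (findT_meets (p := 3) hN (hnb.trans hE) fun u _ => elemT_meets hN hX)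
      fun o _ => ?_))
    cases o with
    | some u =>
      refine Meets.pure ?_
      rintro _ ⟨rfl⟩
      simp only [List.length_cons]
      omega
    | none =>
      refine Meets.bindT hN (foldT_meets (p := 5) hN (fun (i : ℕ) (s : List (List α) × List α) =>
        s.1.length ≤ i ∧ s.2.length ≤ seen.length + i ∧ ∀ w ∈ s.1, w.length + 2 * r ≤ N)
        (hnb.trans hE) (by simp) fun i u s hi _ hs' => ?_) fun next hnext => ?_
      · refine Meets.bindP hN (neighboursT_meets hN hM) fun l _ => ?_
        cases l with
        | nil => exact Meets.pure ⟨by omega, by omega, hs'.2.2⟩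
        | cons x l =>
          refine Meets.bindP hN (elemT_meets hN (by omega)) fun b _ =>
            Meets.ite (fun _ => Meets.pure ⟨by omega, by omega, hs'.2.2⟩) fun _ =>
            Meets.pure ⟨by simp only [List.length_cons]; omega,
              by simp only [List.length_cons]; omega, fun w hw => ?_⟩
          rcases List.mem_cons.1 hw with rfl | hw
          · simp only [List.length_cons]; omega
          · exact hs'.2.2 w hw
      · refine Meets.bindT hN (reverseT_meets hN (by omega)) fun fresh hfresh =>
          Meets.bindT hN (appendT_meets hN (by omega)) fun queue₁ hqueue₁ => ?_
        subst hfresh hqueue₁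
        refine (alternatingWalkT_meets hN hE hM hX r _ _ ?_ ?_ ?_).tail
        · simp only [List.length_append, List.length_reverse]; omega
        · omega
        · intro w hw
          rcases List.mem_append.1 hw with h | h
          · have := hW w (by simp [h])
            omega
          · exact hnext.2.2 w (List.mem_reverse.1 h)

/-- The size parameter of a round is `N ^ 3`, which bounds the lengths of the queue and the walks of
the search. -/
theorem augmentableT_meets (hN : 4 ≤ N) : ∀ (r : ℕ) (V : List α) (E M : List (α × α)),
    V.length ≤ N → E.length ≤ N → M.length ≤ N →
    Meets (augmentableT r V E M) ((r + 1) * (N ^ 3) ^ 30) fun _ => True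
  | 0, V, E, M, _, _, _ => by
    rw [augmentableT]
    exact Meets.tick_pure (by positivity) (by simp)
  | r + 1, V, E, M, hV, hE, hM => by
    have hA : 4 ≤ N ^ 3 := four_le_pow hN (by norm_num)
    have hN2 : 16 ≤ N ^ 2 := by nlinarith
    have hNA : 8 * N ≤ N ^ 3 := by rw [pow_succ]; nlinarith
    have hNA2 : N + (N + 1) * N ≤ N ^ 3 := by nlinarith
    rw [augmentableT]
    refine Meets.round (Meets.tickT hA (Meets.bindT hA (filterT_meets_length (p := 4) hA
      (by omega) fun v _ => (coversT_meets hA (by omega)).bindP hA fun _ _ => Meets.pure_true)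
      fun X hX => ?_))
    refine Meets.bindT hA (mapT_meets (p := 0) (Q := fun W : List α => W.length = 1) hA
      (by omega) fun v _ => Meets.pure rfl) fun start hstart => ?_
    refine Meets.bindT hA (lengthT_meets hA (by omega)) fun size hsize => ?_
    have hsE : (size + 1) * E.length ≤ (N + 1) * N := Nat.mul_le_mul (by omega) hE
    refine Meets.bindT hA ((alternatingWalkT_meets hA (by omega) (by omega) (by omega)
      (size + 1) start X (by omega) (by omega) fun W hW => ?_).rounds (by omega)) fun o ho => ?_
    · rw [hstart.2 W hW]; omega
    cases o with
    | none => exact Meets.pure_true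
    | some W =>
      have hW := ho W rfl
      refine Meets.bindT hA (reverseT_meets hA hW) fun walk hwalk => ?_
      subst hwalk
      refine Meets.bindT hA (q := 7) ((firstCycleT_meets hA W.reverse [] (by simpa using hW)).mono
        ?_ fun _ h => h) fun o ho => ?_
      · rw [List.length_reverse]
        calc (W.length + 1) * (N ^ 3) ^ 5 ≤ (N ^ 3 * N ^ 3) * (N ^ 3) ^ 5 := by
              gcongr; nlinarith
          _ = (N ^ 3) ^ 7 := by ring
      rcases o with _ | _ | ⟨c, B⟩
      · exact Meets.pure_true
      · exact Meets.pure_true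
      · have hB := ho _ rfl
        have hB' : B.length ≤ N ^ 3 := by simp only [List.length_cons] at hB; omega
        refine Meets.bindT hA (filterT_meets_length (p := 4) hA (by omega) fun v _ =>
          (elemT_meets hA hB').bindP hA fun _ _ => Meets.pure_true) fun V₁ hV₁ => ?_
        refine Meets.bindT hA (shrinkEdgesT_meets hA hB (by omega)) fun E₁ hE₁ =>
          Meets.bindT hA (shrinkEdgesT_meets (E := M) hA hB (by omega)) fun M₁ hM₁ =>
          (augmentableT_meets hN r V₁ E₁ M₁ (by omega) (by omega) (by omega)).tail

theorem augmentableT_meets_pow (hN : 4 ≤ N) {r : ℕ} {V : List α} {E M : List (α × α)}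
    (hr : r + 1 ≤ N) (hV : V.length ≤ N) (hE : E.length ≤ N) (hM : M.length ≤ N) :
    Meets (augmentableT r V E M) (N ^ 91) fun _ => True := by
  have h := augmentableT_meets hN r V E M hV hE hM
  rw [← pow_mul] at h
  exact h.rounds hr

theorem pruneT_meets (hN : 4 ≤ N) {size : ℕ} {V : List α} {M : List (α × α)}
    (hs : size ≤ N) (hV : V.length ≤ N) (hM : M.length ≤ N) : ∀ (rest kept : List (α × α)),
    kept.length + rest.length ≤ N →
    Meets (pruneT size V M kept rest) ((rest.length + 1) * (N ^ 2) ^ 95)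
      fun r => r.length ≤ kept.length + rest.length
  | [], kept, _ => by
    rw [pruneT]
    exact Meets.tick_pure (by positivity) (by simp)
  | e :: rest, kept, h => by
    rw [pruneT]
    simp only [List.length_cons] at h ⊢
    have hA : 4 ≤ N ^ 2 := four_le_pow hN (by norm_num)
    have hNA : 4 * N ≤ N ^ 2 := by nlinarith
    refine Meets.round (Meets.tickT hA (Meets.bindT hA (appendT_meets hA (by omega)) fun E₀ hE₀ =>
      Meets.bindT hA (appendT_meets hA ?_) fun E₁ hE₁ => Meets.bindT hA
        (augmentableT_meets_pow hA (by omega) (by omega) ?_ (by omega)) fun b _ =>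
      Meets.ite (fun _ => (pruneT_meets hN hs hV hM rest kept (by omega)).tail.mono le_rfl
        fun r hr => by omega)
        fun _ => (pruneT_meets hN hs hV hM rest (e :: kept)
          (by simp only [List.length_cons]; omega)).tail.mono le_rfl fun r hr => by
          simp only [List.length_cons] at hr; omega))
    all_goals
      subst hE₀
      try subst hE₁
      simp only [List.length_append]
      omega

theorem augmentT_meets (hN : 4 ≤ N) {size : ℕ} {V : List α} {E M : List (α × α)}
    (hs : size ≤ N) (hV : V.length ≤ N) (hE : E.length ≤ N) (hM : M.length ≤ N) :
    Meets (augmentT size V E M) (N ^ 196) fun r => r.length ≤ E.length + M.length := by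
  have hNA : 2 * N ≤ N ^ 2 := by nlinarith
  rw [augmentT]
  refine Meets.bindP hN (filterT_meets_length (p := 5) hN hE fun e _ =>
    (elemT_meets hN hM).bindP hN fun _ _ => (elemT_meets hN hM).bindP hN fun _ _ =>
      Meets.pure_true) fun E₁ hE₁ => ?_
  refine Meets.bindP hN (q := 192) ((pruneT_meets hN hs hV hM E₁ [] (by simp; omega)).mono ?_
    fun _ h => h) fun path hpath => ?_
  · calc (E₁.length + 1) * (N ^ 2) ^ 95 ≤ N ^ 2 * (N ^ 2) ^ 95 := by gcongr; omega
      _ = N ^ 192 := by ring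
  simp only [List.length_nil, zero_add] at hpath
  refine Meets.bindP hN (filterT_meets_length (p := 5) hN hM fun e _ =>
    (coversT_meets hN (by omega)).bindP hN fun _ _ => (coversT_meets hN (by omega)).bindP hN
      fun _ _ => Meets.pure_true) fun stay hstay => ?_
  refine (appendT_meets hN (by omega)).mono_pow hN fun r hr => ?_
  subst hr
  simp only [List.length_append]
  omega

/-- An augmentation enlarges the list of matching edges by at most `|E|` entries, the edges
of the augmenting path. -/
theorem maximumMatchingLoopT_meets (hN : 4 ≤ N) {size : ℕ} {V : List α} {E : List (α × α)}
    (hs : size + 2 ≤ N) (hV : V.length ≤ N) (hE : E.length ≤ N) : ∀ (r : ℕ) (M : List (α × α)),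
    M.length + r * E.length ≤ N →
    Meets (maximumMatchingLoopT size V E r M) ((r + 1) * N ^ 200) fun R => R.length ≤ N
  | 0, M, hM => by
    rw [maximumMatchingLoopT]
    exact Meets.tick_pure (by positivity) (by omega)
  | r + 1, M, hM => by
    rw [maximumMatchingLoopT]
    rw [add_mul, one_mul] at hM
    refine Meets.round (Meets.tickT hN (Meets.bindT hN (augmentableT_meets_pow hN (by omega) hV hE
      (by omega)) fun b _ => Meets.ite (fun _ => ?_) fun _ => Meets.pure (by omega)))
    exact Meets.bindT hN (p := 197) (augmentT_meets hN (by omega) hV hE (by omega)) fun M₁ hM₁ =>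
      (maximumMatchingLoopT_meets hN hs hV hE r M₁ (by omega)).tail

theorem maximumMatchingT_meets (hN : 4 ≤ N) {V : List α} {E : List (α × α)}
    (hV : V.length ≤ N) (hE : E.length ≤ N) :
    Meets (maximumMatchingT V E) (N ^ 404) fun R => R.length ≤ N ^ 2 := by
  have hA : 4 ≤ N ^ 2 := four_le_pow hN (by norm_num)
  have hNA : 4 * N ≤ N ^ 2 := by nlinarith
  refine Meets.pow_mul 2 202 ?_
  rw [maximumMatchingT]
  refine Meets.bindP hA (lengthT_meets hA (by omega)) fun size hsize => ?_
  have hVE : size * E.length ≤ N * N := Nat.mul_le_mul (by omega) hE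
  exact (maximumMatchingLoopT_meets hA (by omega) (by omega) (by omega) size []
    (by rw [List.length_nil]; nlinarith)).rounds (by omega)

end Matching

/-! ### Weighted edges and top-k weights -/

section Weighted

variable {α : Type} [DecidableEq α] {N : ℕ}

theorem touchesT_meets (hN : 4 ≤ N) {M : List (WEdge α)} {x : α} (hM : M.length ≤ N) :
    Meets (touchesT M x) (N ^ 3) fun _ => True :=
  anyT_meets (p := 0) hN hM fun _ _ => Meets.pure_true

theorem inducedT_meets (hN : 4 ≤ N) {V : List α} {E : List (WEdge α)} (hV : V.length ≤ N)
    (hE : E.length ≤ N) :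
    Meets (inducedT V E) (N ^ 7) fun r => r.length ≤ E.length ∧ ∀ e ∈ r, e ∈ E :=
  filterT_meets_length (p := 5) hN hE fun _ _ => (elemT_meets hN hV).bindP hN fun _ _ =>
    (elemT_meets hN hV).bindP hN fun _ _ => Meets.pure_true

theorem untouchedT_meets (hN : 4 ≤ N) {V : List α} {M : List (WEdge α)} (hV : V.length ≤ N)
    (hM : M.length ≤ N) : Meets (untouchedT V M) (N ^ 6) fun r => r.length ≤ V.length :=
  (filterT_meets_length (p := 4) hN hV fun _ _ => (touchesT_meets hN hM).bindP hN fun _ _ =>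
    Meets.pure_true).mono le_rfl fun _ h => h.1

theorem perfectMatchingT_meets (hN : 4 ≤ N) {V : List α} {E : List (WEdge α)}
    (hV : V.length ≤ N) (hE : E.length ≤ N) :
    Meets (perfectMatchingT V E) (N ^ 410) fun o => ∀ M, o = some M → M.length ≤ N ^ 2 := by
  have hA : 4 ≤ N ^ 2 := four_le_pow hN (by norm_num)
  have hNA : N ≤ N ^ 2 := Nat.le_self_pow (by norm_num) N
  rw [perfectMatchingT]
  refine Meets.bindP hN (mapT_meets (p := 0) (Q := fun _ => True) hN hE fun _ _ =>
    Meets.pure_true) fun E₁ hE₁ => ?_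
  refine Meets.bindP hN (maximumMatchingT_meets hN hV (hE₁.1.le.trans hE)) fun M hM => ?_
  refine Meets.bindP hN (Meets.of_pow 2 2 (lengthT_meets hA hM)) fun s _ =>
    Meets.bindP hN (lengthT_meets hN hV) fun t _ => Meets.ite (fun _ => ?_) fun _ =>
    Meets.pure (by simp)
  refine Meets.bindP hN (Meets.of_pow 2 4 (filterMapT_meets (p := 2) (Q := fun _ => True)
    hA hM fun e _ => (findT_meets (p := 0) (P := fun _ _ => True) hA (hE.trans hNA) fun _ _ =>
      Meets.pure_true).mono le_rfl fun _ _ _ _ => trivial)) fun M₁ hM₁ => Meets.pure ?_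
  rintro _ ⟨rfl⟩
  exact hM₁.1.trans hM

end Weighted

section TopK

variable {α : Type} {N : ℕ}

theorem insertT_meets (q : ℚ) : ∀ l : List ℚ,
    Meets (insertT q l) (l.length + 1) fun r => r.length = l.length + 1
  | [] => by
    rw [insertT]
    exact Meets.tick_pure (by simp) (by simp)
  | r :: l => by
    rw [insertT]
    exact Meets.tick_bind (Meets.ite (fun _ => Meets.pure (by simp)) fun _ =>
      (insertT_meets q l).bind (t := 0) fun s hs => Meets.pure (by simp [hs]))

theorem sumFirstT_meets : ∀ (k : ℕ) (l : List ℚ),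
    Meets (sumFirstT k l) (l.length + 1) fun _ => True
  | 0, l => by
    rw [sumFirstT]
    exact Meets.tick_pure (by simp) (by simp)
  | k + 1, [] => by
    rw [sumFirstT]
    exact Meets.tick_pure (by simp) (by simp)
  | k + 1, q :: l => by
    rw [sumFirstT]
    exact Meets.tick_bind ((sumFirstT_meets k l).bind (t := 0) fun s hs => Meets.pure_true)

theorem topkT_meets (hN : 4 ≤ N) {k : ℕ} {M : List (WEdge α)} (hM : M.length ≤ N) :
    Meets (topkT k M) (N ^ 5) fun _ => True :=
  (foldT_meets (p := 2) hN (fun (i : ℕ) (l : List ℚ) => l.length = i) hM rfl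
    fun i e l hi _ hl => (insertT_meets e.w l).mono (by nlinarith) fun r hr => by omega).bindP hN
    fun l hl => (sumFirstT_meets k l).mono (t := N ^ 4)
      (by rw [hl]; have : N ^ 0 + N ^ 3 ≤ N ^ 4 := pow_add_pow_le hN (Nat.zero_le 3)
          have h1 : N ≤ N ^ 3 := Nat.le_self_pow (by norm_num) N
          rw [pow_zero] at this; omega) fun _ h => h

theorem betterT_meets (hN : 4 ≤ N) {k : ℕ} {M : List (WEdge α)} {o : Option (List (WEdge α))}
    (hM : M.length ≤ N) (ho : ∀ B, o = some B → B.length ≤ N) :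
    Meets (betterT k M o) (N ^ 8) fun _ => True := by
  cases o with
  | none =>
    rw [betterT]
    exact Meets.tick_pure (by positivity) trivial
  | some B =>
    rw [betterT]
    exact Meets.tickP hN ((topkT_meets hN hM).bindP hN fun _ _ =>
      (topkT_meets hN (ho B rfl)).bindP hN fun _ _ => Meets.pure_true)

end TopK

/-! ### Maximum weight perfect matching -/

section PrimalDual

variable {α : Type} [DecidableEq α] {N : ℕ}

theorem lookupT_meets (hN : 4 ≤ N) {y : List (α × ℚ)} {x : α} (hy : y.length ≤ N) :
    Meets (lookupT y x) (N ^ 3) fun _ => True :=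
  (findT_meets (p := 0) (P := fun _ _ => True) hN hy fun _ _ => Meets.pure_true).bindP hN
    fun _ _ => Meets.pure_true

theorem nodeT_meets (hN : 4 ≤ N) {F : List (Blossom α)} {x : α} (hF : F.length ≤ N)
    (hB : ∀ B ∈ F, B.verts.length ≤ N) : Meets (nodeT F x) (N ^ 6) fun _ => True :=
  (findT_meets (p := 3) (P := fun _ _ => True) hN hF fun B h => elemT_meets hN (hB B h)).bindP hN
    fun _ _ => Meets.pure_true

theorem slackT_meets (hN : 4 ≤ N) {y : List (α × ℚ)} {F : List (Blossom α)} {e : WEdge α}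
    (hy : y.length ≤ N) (hF : F.length ≤ N) (hB : ∀ B ∈ F, B.verts.length ≤ N) :
    Meets (slackT y F e) (N ^ 9) fun _ => True :=
  (lookupT_meets hN hy).bindP hN fun _ _ => (lookupT_meets hN hy).bindP hN fun _ _ =>
    foldT_meets (p := 5) hN (fun _ _ => True) hF trivial fun _ B _ _ h _ =>
      (elemT_meets hN (hB B h)).bindP hN fun _ _ => (elemT_meets hN (hB B h)).bindP hN
        fun _ _ => Meets.pure_true

theorem shrunkEdgesT_meets (hN : 4 ≤ N) {F : List (Blossom α)} {E : List (WEdge α)}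
    (hE : E.length ≤ N) (hF : F.length ≤ N) (hB : ∀ B ∈ F, B.verts.length ≤ N) :
    Meets (shrunkEdgesT F E) (N ^ 10) fun r => r.length ≤ E.length :=
  (filterMapT_meets (p := 8) (Q := fun _ => True) hN hE fun _ _ =>
    (nodeT_meets hN hF hB).bindP hN fun _ _ => (nodeT_meets hN hF hB).bindP hN fun _ _ =>
    Meets.pure fun _ _ => trivial).mono le_rfl fun _ h => h.1

theorem liftT_meets (hN : 4 ≤ N) {L : List (WEdge α × α × α)} {M : List (α × α)}
    (hL : L.length ≤ N) (hM : M.length ≤ N) :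
    Meets (liftT L M) (N ^ 5) fun r => r.length ≤ M.length :=
  (filterMapT_meets (p := 3) (Q := fun _ => True) hN hM fun _ _ =>
    (findT_meets (p := 0) (P := fun _ _ => True) hN hL fun _ _ => Meets.pure_true).bindP hN
    fun _ _ => Meets.pure fun _ _ => trivial).mono le_rfl fun _ h => h.1

/-- Every blossom adds the edges of a matching, of which there are at most `N ^ 2`. -/
theorem expandT_meets (hN : 4 ≤ N) {A : ℕ} (hNA : N ≤ A) {tight : List (WEdge α)}
    (ht : tight.length ≤ N) : ∀ (F : List (Blossom α)) (R : List (WEdge α)),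
    F.length ≤ A → (∀ B ∈ F, B.verts.length ≤ N) → R.length + F.length * N ^ 2 ≤ A →
    Meets (expandT tight F R) ((F.length + 1) * A ^ 420) fun r => r.length ≤ A
  | [], R, _, _, hR => by
    have : 0 < A := by omega
    rw [expandT]
    exact Meets.tick_pure (by positivity) (by simpa using hR)
  | B :: F, R, hF, hB, hR => by
    have hA : 4 ≤ A := hN.trans hNA
    have hBv := (hB B (by simp))
    have hF' : ∀ B ∈ F, B.verts.length ≤ A := fun C hC =>
      (hB C (List.mem_cons_of_mem _ hC)).trans hNA
    rw [expandT]
    simp only [List.length_cons, add_mul, one_mul] at hF hR ⊢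
    rw [← add_one_mul, ← add_one_mul]
    refine Meets.round (Meets.tickT hA (Meets.bindT hA (filterT_meets_length (p := 3) hA
      (hBv.trans hNA) fun _ _ => touchesT_meets hA (by omega)) fun covered hc => ?_))
    refine Meets.bindT hA (mapT_meets (p := 6) (Q := fun _ => True) hA (by omega) fun _ _ =>
      nodeT_meets hA (by omega) hF') fun removed hr => ?_
    refine Meets.bindT hA (filterT_meets_length (p := 8) hA (hBv.trans hNA) fun _ _ =>
      (nodeT_meets hA (by omega) hF').bindP hA fun _ _ => (elemT_meets hA (by omega)).bindP hA
      fun _ _ => Meets.pure_true) fun nodes hn => ?_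
    refine Meets.bindT hA (inducedT_meets hA (hBv.trans hNA) (ht.trans hNA)) fun inside hi => ?_
    refine Meets.bindT hA (shrunkEdgesT_meets hA (by omega) (by omega) hF') fun shrunk hs => ?_
    refine Meets.bindT hA (filterT_meets_length (p := 5) hA (by omega) fun _ _ =>
      (elemT_meets hA (by omega)).bindP hA fun _ _ => (elemT_meets hA (by omega)).bindP hA
      fun _ _ => Meets.pure_true) fun L hL => ?_
    refine Meets.bindT hA (mapT_meets (p := 0) (Q := fun _ => True) hA (by omega) fun _ _ =>
      Meets.pure_true) fun E₁ hE₁ => ?_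
    refine Meets.bindT hA (((maximumMatchingT_meets hN (V := nodes) (E := E₁) (by omega)
      (by omega))).mono (Nat.pow_le_pow_left hNA 404) fun _ h => h) fun M hM => ?_
    refine Meets.bindT hA (liftT_meets hA (by omega) (by omega)) fun N₁ hN₁ => ?_
    refine Meets.bindT hA (appendT_meets hA (by omega)) fun N₂ hN₂ => ?_
    subst hN₂
    refine (expandT_meets hN hNA ht F (N₁ ++ R) (by omega)
      (fun C hC => hB C (List.mem_cons_of_mem _ hC)) ?_).tail
    rw [List.length_append]
    omega

theorem inessentialT_meets (hN : 4 ≤ N) {V : List α} {E M : List (α × α)}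
    (hV : V.length + 2 ≤ N) (hE : E.length ≤ N) (hM : M.length ≤ N) :
    Meets (inessentialT V E M) (N ^ 99) fun r => r.length ≤ V.length := by
  rw [inessentialT]
  refine Meets.bindP hN (lengthT_meets hN (by omega)) fun size hs => ?_
  refine (filterT_meets_length (p := 96) (P := fun _ _ => True) hN (by omega)
    fun x _ => ?_).mono_pow hN fun _ h => h.1
  refine Meets.bindP hN (coversT_meets hN hM) fun b _ => Meets.ite (fun _ => ?_) fun _ =>
    Meets.pure_true
  refine Meets.bindP hN (filterT_meets_length (p := 0) hN (by omega) fun _ _ =>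
    Meets.pure_true) fun V₁ hV₁ => ?_
  refine Meets.bindP hN (filterT_meets_length (p := 0) hN hE fun _ _ =>
    Meets.pure_true) fun E₁ hE₁ => ?_
  refine Meets.bindP hN (filterT_meets_length (p := 0) hN hM fun _ _ =>
    Meets.pure_true) fun M₁ hM₁ => ?_
  exact (augmentableT_meets_pow hN (by omega) (by omega) (by omega) (by omega)).mono_pow hN
    fun _ h => h

theorem tagMaximalT_meets (hN : 4 ≤ N) {F : List (Blossom α)} (hF : F.length ≤ N)
    (hB : ∀ B ∈ F, B.verts.length ≤ N) :
    Meets (tagMaximalT F) (N ^ 16) fun r => r.length = F.length ∧ ∀ t ∈ r, t.1 ∈ F := by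
  have hA : 4 ≤ N ^ 2 := four_le_pow hN (by norm_num)
  have hNA : N ≤ N ^ 2 := Nat.le_self_pow (by norm_num) N
  refine Meets.pow_mul 2 8 ?_
  rw [tagMaximalT]
  refine Meets.bindP hA (foldT_meets (p := 5) hA
    (fun (i : ℕ) (s : List (Blossom α × Bool) × List α) =>
      s.1.length = i ∧ s.2.length ≤ i * N ∧ ∀ t ∈ s.1, t.1 ∈ F) (hF.trans hNA)
      (by simp) fun i B s hi hBF hs => ?_) fun r hr => ?_
  · have hs2 : s.2.length ≤ N ^ 2 := hs.2.1.trans (by nlinarith)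
    refine Meets.bindP hA (elemT_meets hA hs2) fun _ _ => Meets.bindP hA (p := 3)
      (appendT_meets hA ((hB B hBF).trans hNA)) fun past hp => Meets.pure ?_
    subst hp
    refine ⟨by simp [hs.1], ?_, ?_⟩
    · simp only [List.length_append, add_mul, one_mul]
      have := hB B hBF
      omega
    · intro t ht
      rcases List.mem_cons.1 ht with rfl | ht
      · exact hBF
      · exact hs.2.2 t ht
  · refine (reverseT_meets hA (by omega)).mono_pow hA fun u hu => ?_
    subst hu
    exact ⟨by simp [hr.1], fun t ht => hr.2.2 t (List.mem_reverse.1 ht)⟩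

theorem minT_meets (hN : 4 ≤ N) {l : List ℚ} (hl : l.length ≤ N) :
    Meets (minT l) (N ^ 2) fun _ => True :=
  foldT_meets (p := 0) hN (fun _ _ => True) hl trivial fun _ _ _ _ _ _ => Meets.pure_true

/-- A dual change adds at most one blossom for every component in `K`. -/
theorem dualChangeT_meets (hN : 4 ≤ N) {m : ℕ} (hm : m ≤ N) {V : List α} {y : List (α × ℚ)}
    {F : List (Blossom α)} {L : List (WEdge α × α × α)} {D A : List α} {K : List (List α)}
    (hV : V.length ≤ m) (hy : y.length ≤ N) (hF : F.length ≤ N)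
    (hB : ∀ B ∈ F, B.verts.length ≤ m) (hL : L.length ≤ N) (hD : D.length ≤ N)
    (hAN : A.length ≤ N) (hK : K.length ≤ N) (hC : ∀ C ∈ K, C.length ≤ N) :
    Meets (dualChangeT V y F L D A K) (N ^ 30) fun o => ∀ r, o = some r →
      r.1.length = y.length ∧ r.2.length ≤ K.length + F.length ∧
        ∀ B ∈ r.2, B.verts.length ≤ m := by
  have hBN : ∀ B ∈ F, B.verts.length ≤ N := fun B h => (hB B h).trans hm
  have hnode : ∀ x, Meets (nodeT F x) (N ^ 6) fun _ => True := fun x => nodeT_meets hN hF hBN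
  have heD : ∀ x, Meets (elemT x D) (N ^ 3) fun _ => True := fun x => elemT_meets hN hD
  have heA : ∀ x, Meets (elemT x A) (N ^ 3) fun _ => True := fun x => elemT_meets hN hAN
  rw [dualChangeT]
  refine Meets.bindP hN (tagMaximalT_meets hN hF hBN) fun tagged ht => ?_
  refine Meets.bindP hN (filterMapT_meets (p := 15) (Q := fun _ => True) hN hL fun t _ => ?_)
    fun edgeBounds he => ?_
  · refine Meets.bindP hN (slackT_meets hN hy hF hBN) fun s _ => (heD _).bindP hN fun a _ =>
      (heD _).bindP hN fun b _ => (heA _).bindP hN fun c _ => (heA _).bindP hN fun d _ =>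
      Meets.ite (fun _ => ?_) fun _ => Meets.pure fun _ _ => trivial
    exact Meets.bindP hN (anyT_meets (p := 5) hN hK fun C hCK =>
      (elemT_meets hN (hC C hCK)).bindP hN fun _ _ => (elemT_meets hN (hC C hCK)).bindP hN
      fun _ _ => Meets.pure_true) fun _ _ => Meets.pure fun _ _ => trivial
  refine Meets.bindP hN (filterMapT_meets (p := 4) (Q := fun _ => True) hN (by omega) fun t _ =>
    (heA _).bindP hN fun _ _ => Meets.pure fun _ _ => trivial) fun blossomBounds hb => ?_
  refine Meets.bindP hN (appendT_meets hN (by omega)) fun bounds hbd => ?_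
  have hbd' : bounds.length ≤ N ^ 2 := by
    subst hbd
    rw [List.length_append]
    nlinarith
  refine Meets.bindP hN (Meets.of_pow 2 2
    (minT_meets (four_le_pow hN (by norm_num)) hbd')) fun o _ => ?_
  cases o with
  | none => exact Meets.pure (by simp)
  | some δ =>
    refine Meets.bindP hN (mapT_meets (p := 9) (Q := fun _ => True) hN hy fun q _ =>
      (hnode _).bindP hN fun x _ => (heD _).bindP hN fun a _ => (heA _).bindP hN fun b _ =>
      Meets.pure_true) fun y₁ hy₁ => ?_
    refine Meets.bindP hN (mapT_meets (p := 5) (Q := fun B : Blossom α => B.verts.length ≤ m) hN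
      (by omega) fun t htt => (heA _).bindP hN fun a _ => (anyT_meets (p := 0) hN hK fun _ _ =>
      Meets.pure_true).bindP hN fun _ _ => Meets.pure (hB t.1 (ht.2 t htt))) fun old ho => ?_
    refine Meets.bindP hN (filterT_meets_length (p := 0) hN (by omega) fun _ _ =>
      Meets.pure_true) fun old₁ ho₁ => ?_
    refine Meets.bindP hN (filterMapT_meets (p := 11)
      (Q := fun B : Blossom α => B.verts.length ≤ m) hN hK fun C hCK => ?_) fun new hnew => ?_
    · rcases C with _ | ⟨x, _ | ⟨x', C⟩⟩
      · exact Meets.pure (by simp)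
      · exact Meets.pure (by simp)
      · refine Meets.bindP hN (filterT_meets_length (p := 8) hN (hV.trans hm) fun v _ =>
          (hnode v).bindP hN fun a _ => (elemT_meets hN (hC _ hCK)).mono_pow hN fun _ h => h)
          fun verts hverts => Meets.pure ?_
        rintro _ ⟨rfl⟩
        exact hverts.1.trans hV
    refine Meets.bindP hN (appendT_meets hN (by omega)) fun F₁ hF₁ => Meets.pure ?_
    rintro _ ⟨rfl⟩
    subst hF₁
    refine ⟨hy₁.1, ?_, fun B hBm => ?_⟩
    · simp only [List.length_append]
      omega
    · rcases List.mem_append.1 hBm with h | h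
      · exact hnew.2 B h
      · exact ho.2 B (ho₁.2 B h)

/-- The list of blossoms grows by at most `|V| + |E|` per round, so that it remains
polynomially long for polynomially many rounds, whether or not the family is laminar. -/
theorem weightedLoopT_meets (hN : 4 ≤ N) {V : List α} {E : List (WEdge α)}
    (hV : V.length + 2 ≤ N) (hE : E.length ≤ N) : ∀ (r : ℕ) (y : List (α × ℚ))
    (F : List (Blossom α)), y.length = V.length →
    F.length + r * (V.length + E.length) ≤ N → (∀ B ∈ F, B.verts.length ≤ V.length) →
    Meets (weightedLoopT V E r y F) ((r + 1) * N ^ 1720)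
      fun o => ∀ M, o = some M → M.length ≤ N ^ 4
  | 0, y, F, _, _, _ => by
    rw [weightedLoopT]
    exact Meets.tick_pure (by positivity) (by simp)
  | r + 1, y, F, hy, hF, hB => by
    have hFN : F.length ≤ N := by omega
    have hBN : ∀ B ∈ F, B.verts.length ≤ N := fun B h => (hB B h).trans (by omega)
    have hA : 4 ≤ N ^ 2 := four_le_pow hN (by norm_num)
    have hNA : N ≤ N ^ 2 := Nat.le_self_pow (by norm_num) N
    have hnode : ∀ x, Meets (nodeT F x) (N ^ 6) fun _ => True := fun x => nodeT_meets hN hFN hBN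
    rw [weightedLoopT]
    refine Meets.round (Meets.tickT hN (Meets.bindT hN (filterT_meets_length (p := 10) hN hE
      fun _ _ => (slackT_meets hN (by omega) hFN hBN).bindP hN fun _ _ => Meets.pure_true)
      fun tight ht => ?_))
    refine Meets.bindT hN (filterT_meets_length (p := 7) hN (by omega) fun x _ =>
      (hnode x).bindP hN fun _ _ => Meets.pure_true) fun nodes hn => ?_
    refine Meets.bindT hN (shrunkEdgesT_meets hN (by omega) hFN hBN) fun LT hLT => ?_
    refine Meets.bindT hN (mapT_meets (p := 0) (Q := fun _ => True) hN (by omega) fun _ _ =>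
      Meets.pure_true) fun H hH => ?_
    refine Meets.bindT hN (maximumMatchingT_meets hN (by omega) (by omega)) fun M hM => ?_
    refine Meets.bindT hN (Meets.of_pow 2 2 (lengthT_meets hA hM)) fun s _ =>
      Meets.bindT hN (lengthT_meets hN (by omega)) fun t _ =>
      Meets.ite (fun _ => ?_) fun _ => ?_
    · refine Meets.bindT hN (Meets.of_pow 2 5 (liftT_meets hA (by omega) hM)) fun R hR => ?_
      have hexp : R.length + F.length * N ^ 2 ≤ N ^ 4 := by
        have h1 : F.length * N ^ 2 ≤ N * N ^ 2 := Nat.mul_le_mul_right _ hFN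
        have h2 : N ^ 2 + N ^ 3 ≤ N ^ 4 := pow_add_pow_le hN (by norm_num)
        have h3 : N * N ^ 2 = N ^ 3 := by ring
        omega
      have hN4 : N ≤ N ^ 4 := Nat.le_self_pow (by norm_num) N
      refine Meets.bindT hN (Meets.of_pow 4 421 ((expandT_meets hN hN4 (by omega) F R
        (hFN.trans hN4) hBN hexp).rounds ?_)) fun R' hR' => Meets.pure ?_
      · have : N ^ 4 = N * N * N ^ 2 := by ring
        nlinarith
      · rintro _ ⟨rfl⟩
        exact hR'
    · refine Meets.bindT hN (Meets.of_pow 2 99 (inessentialT_meets hA (by omega) (by omega) hM))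
        fun D hD => ?_
      refine Meets.bindT hN (filterT_meets_length (p := 5) hN (by omega) fun _ _ =>
        (elemT_meets hN (by omega)).bindP hN fun _ _ => (elemT_meets hN (by omega)).bindP hN
        fun _ _ => Meets.pure_true) fun HD hHD => ?_
      refine Meets.bindT hN (componentsT_meets hN (by omega) (by omega)) fun K hK => ?_
      have hKC : ∀ C ∈ K, C.length ≤ N := fun C hC => by
        have := (List.sublist_flatten_of_mem hC).length_le
        omega
      refine Meets.bindT hN (filterT_meets_length (p := 9) (P := fun _ _ => True) hN (by omega)
        fun x _ => (elemT_meets hN (by omega)).bindP hN fun _ _ =>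
        (neighboursT_meets hN (by omega)).bindP hN fun nb hnb =>
        Meets.bindP hN (anyT_meets (p := 3) (P := fun _ _ => True) hN (by omega) fun _ _ =>
          elemT_meets hN (by omega)) fun _ _ => Meets.pure_true) fun A hA' => ?_
      refine Meets.bindT hN (shrunkEdgesT_meets hN hE hFN hBN) fun L hL => ?_
      rw [add_mul, one_mul] at hF
      refine Meets.bindT hN (dualChangeT_meets hN (m := V.length) (by omega) le_rfl (by omega)
        hFN hB (by omega) (by omega) (by omega) (by omega) hKC) fun o ho => ?_
      rcases o with _ | ⟨y₁, F₁⟩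
      · exact Meets.pure (by simp)
      · obtain ⟨h1, h2, h3⟩ := ho _ rfl
        simp only at h1 h2 h3
        exact (weightedLoopT_meets hN hV hE r y₁ F₁ (by omega) (by omega) h3).tail

theorem maximumWeightPerfectMatchingT_meets (hN : 4 ≤ N) {V : List α} {E : List (WEdge α)}
    (hV : V.length ≤ N) (hE : E.length ≤ N) :
    Meets (maximumWeightPerfectMatchingT V E) (N ^ 10350)
      fun o => ∀ M, o = some M → M.length ≤ N ^ 24 := by
  have hA : 4 ≤ N ^ 6 := four_le_pow hN (by norm_num)
  have h64 : 64 ≤ N ^ 3 := by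
    calc 64 = 4 ^ 3 := by norm_num
      _ ≤ N ^ 3 := Nat.pow_le_pow_left hN 3
  have hA6 : N ^ 6 = N ^ 3 * N ^ 3 := by ring
  have hN3 : N ≤ N ^ 3 := Nat.le_self_pow (by norm_num) N
  have hNA : N + 2 ≤ N ^ 6 := by nlinarith
  refine Meets.pow_mul 6 1725 ?_
  rw [maximumWeightPerfectMatchingT]
  refine Meets.bindP hA (lengthT_meets hA (by omega)) fun size hs => ?_
  refine Meets.bindP hA (foldT_meets (p := 0) hA (fun _ _ => True) (by omega) trivial
    fun _ _ _ _ _ _ => Meets.pure_true) fun W _ => ?_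
  refine Meets.bindP hA (mapT_meets (p := 0) (Q := fun _ => True) hA (by omega) fun _ _ =>
    Meets.pure_true) fun y hy => ?_
  have hr : 4 * (size + 1) ^ 2 ≤ 16 * N ^ 2 := by
    have : size + 1 ≤ 2 * N := by omega
    nlinarith [Nat.pow_le_pow_left this 2]
  have hr2 : 4 * (size + 1) ^ 2 * (V.length + E.length) ≤ 32 * N ^ 3 := by
    calc 4 * (size + 1) ^ 2 * (V.length + E.length) ≤ 16 * N ^ 2 * (2 * N) :=
          Nat.mul_le_mul hr (by omega)
      _ = 32 * N ^ 3 := by ring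
  have hN23 : N ^ 2 ≤ N ^ 3 := Nat.pow_le_pow_right (by omega) (by norm_num)
  refine ((weightedLoopT_meets hA (by omega) (by omega) (4 * (size + 1) ^ 2) y [] hy.1
    (by simp only [List.length_nil]; nlinarith) (by simp)).rounds (by nlinarith)).mono_pow hA
    fun o ho M hM => ?_
  exact (ho M hM).trans_eq (by rw [← pow_mul])

end PrimalDual

/-! ### Top-k perfect matching for bounded neighbourhood diversity -/

section Basic

variable {α : Type} {N : ℕ}

theorem killersT_meets (hN : 4 ≤ N) : ∀ (types : List (List α)) (i : ℕ) (cs : List ℕ),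
    (∀ U ∈ types, U.length ≤ N) →
    Meets (killersT i types cs) ((types.length + 1) * N ^ 8) fun o => ∀ r, o = some r →
      r.length ≤ types.length ∧ ∀ q ∈ r, q.1.length ≤ N ∧ q.2.length ≤ N
  | [], i, cs, _ => by
    rw [killersT]
    exact Meets.tick_pure (by positivity) (by simp)
  | U :: types, i, [], _ => by
    rw [killersT]
    exact Meets.tick_pure (by positivity) (by simp)
  | U :: types, i, c :: cs, h => by
    have hU := h U (by simp)
    rw [killersT]
    simp only [List.length_cons]
    refine Meets.round (Meets.tickT hN (Meets.bindT hN (lengthT_meets hN hU) fun s hs =>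
      Meets.ite (fun _ => Meets.pure (by simp)) fun _ => ?_))
    refine Meets.bindT hN (rangeFromT_meets hN (by omega)) fun js hjs => ?_
    refine Meets.bindT hN (mapT_meets (p := 0) (Q := fun _ => True) hN (by omega) fun _ _ =>
      Meets.pure_true) fun K hK => ?_
    refine Meets.tail (((killersT_meets hN types (i + 1) cs fun V hV =>
      h V (List.mem_cons_of_mem _ hV)).bind (t := 0) fun o ho => ?_).mono le_rfl fun _ h => h)
    cases o with
    | none => exact Meets.pure (by simp)
    | some r =>
      obtain ⟨h1, h2⟩ := ho r rfl
      refine Meets.pure ?_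
      rintro _ ⟨rfl⟩
      refine ⟨by simpa using h1, fun q hq => ?_⟩
      rcases List.mem_cons.1 hq with rfl | hq
      · exact ⟨hU, by simp only; omega⟩
      · exact h2 q hq

variable [DecidableEq α]

theorem typeConstrainedT_meets (hN : 4 ≤ N) {types : List (List α)} {E : List (WEdge α)}
    {c : List ℕ} (hγ : types.length + 1 ≤ N) (ht : ∀ U ∈ types, U.length ≤ N)
    (hE : E.length ≤ N) :
    Meets (typeConstrainedT types E c) (N ^ 52000)
      fun o => ∀ M, o = some M → M.length ≤ N ^ 120 := by
  have hA : 4 ≤ N ^ 5 := four_le_pow hN (by norm_num)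
  have hNA : N ≤ N ^ 5 := Nat.le_self_pow (by norm_num) N
  have h2 : N ^ 2 + N ^ 2 ≤ N ^ 5 := (pow_add_pow_le hN le_rfl).trans
    (Nat.pow_le_pow_right (by omega) (by norm_num))
  have h3 : N ^ 1 + N ^ 3 ≤ N ^ 5 := (pow_add_pow_le hN (by norm_num)).trans
    (Nat.pow_le_pow_right (by omega) (by norm_num))
  have hB : N ^ 5 ≤ (N ^ 5) ^ 24 := Nat.le_self_pow (by norm_num) _
  have hB4 : 4 ≤ (N ^ 5) ^ 24 := four_le_pow hA (by norm_num)
  rw [pow_one] at h3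
  refine Meets.pow_mul 5 10400 ?_
  rw [typeConstrainedT]
  refine Meets.bindP hA (q := 9) ((killersT_meets hN types 0 c ht).mono ?_ fun _ h => h)
    fun o ho => ?_
  · calc (types.length + 1) * N ^ 8 ≤ N ^ 5 * (N ^ 5) ^ 8 := by gcongr; omega
      _ = (N ^ 5) ^ 9 := by ring
  cases o with
  | none => exact Meets.pure (by simp)
  | some parts =>
    obtain ⟨hp, hparts⟩ := ho parts rfl
    refine Meets.bindP hA (flattenT_meets hA (by omega) fun U hU => (ht U hU).trans hNA)
      fun V hV => ?_
    have hVl : V.length ≤ N ^ 2 := by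
      subst hV
      exact (length_flatten_le (a := N) (by omega) ht).trans_eq (by ring)
    refine Meets.bindP hA (mapT_meets (p := 0) (Q := fun _ => True) hA (by omega) fun _ _ =>
      Meets.pure_true) fun V₁ hV₁ => ?_
    refine Meets.bindP hA (mapT_meets (p := 2)
      (Q := fun K : List (α ⊕ (ℕ × ℕ)) => K.length ≤ N) hA (by omega) fun q hq =>
      (mapT_meets (p := 0) (Q := fun _ => True) hA ((hparts q hq).2.trans hNA) fun _ _ =>
        Meets.pure_true).mono le_rfl fun r hr => hr.1.le.trans (hparts q hq).2) fun Ks hKs => ?_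
    refine Meets.bindP hA (flattenT_meets hA (by omega) fun K hK => (hKs.2 K hK).trans hNA)
      fun V₂ hV₂ => ?_
    have hV₂l : V₂.length ≤ N ^ 2 := by
      subst hV₂
      exact (length_flatten_le (a := N) (by omega) hKs.2).trans_eq (by ring)
    refine Meets.bindP hA (appendT_meets hA (by omega)) fun V₃ hV₃ => ?_
    refine Meets.bindP hA (mapT_meets (p := 0) (Q := fun _ => True) hA (by omega) fun _ _ =>
      Meets.pure_true) fun E₁ hE₁ => ?_
    refine Meets.bindP hA (mapT_meets (p := 7)
      (Q := fun l : List (WEdge (α ⊕ (ℕ × ℕ))) => l.length ≤ N * N) hA (by omega) fun q hq =>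
      Meets.bindP hA (mapT_meets (p := 2)
        (Q := fun l : List (WEdge (α ⊕ (ℕ × ℕ))) => l.length ≤ N) hA
        ((hparts q hq).1.trans hNA) fun x _ => (mapT_meets (p := 0) (Q := fun _ => True) hA
          ((hparts q hq).2.trans hNA) fun _ _ => Meets.pure_true).mono le_rfl
          fun r hr => hr.1.le.trans (hparts q hq).2) fun l hl =>
      (flattenT_meets hA (by have := (hparts q hq).1; omega) fun a ha =>
        (hl.2 a ha).trans hNA).mono_pow hA fun r hr => by
          subst hr
          exact length_flatten_le (by have := (hparts q hq).1; omega) hl.2) fun Es hEs => ?_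
    have hNN : N * N ≤ N ^ 5 := by
      have : N * N = N ^ 2 := by ring
      omega
    refine Meets.bindP hA (flattenT_meets hA (by omega) fun K hK => (hEs.2 K hK).trans hNN)
      fun E₂ hE₂ => ?_
    have hE₂l : E₂.length ≤ N ^ 3 := by
      subst hE₂
      exact (length_flatten_le (a := N) (by omega) hEs.2).trans_eq (by ring)
    refine Meets.bindP hA (appendT_meets hA (by omega)) fun E₃ hE₃ => ?_
    have hV₃l : V₃.length ≤ N ^ 5 := by
      subst hV₃
      rw [List.length_append]
      omega
    have hE₃l : E₃.length ≤ N ^ 5 := by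
      subst hE₃
      rw [List.length_append]
      omega
    refine Meets.bindP hA (maximumWeightPerfectMatchingT_meets hA hV₃l hE₃l) fun o ho => ?_
    cases o with
    | none => exact Meets.pure (by simp)
    | some M =>
      refine Meets.bindP hA (Meets.of_pow 24 2 (filterMapT_meets (p := 0) (Q := fun _ => True)
        hB4 (ho M rfl) fun _ _ => Meets.pure fun _ _ => trivial)) fun R hR => Meets.pure ?_
      rintro _ ⟨rfl⟩
      refine (hR.1.trans (ho M rfl)).trans_eq ?_
      rw [← pow_mul]

/-- The algorithm for bounded neighbourhood diversity is polynomial in the size of the graph and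
the number `(2 * k + 1) ^ γ`, where `γ` is the number of types. -/
theorem basicT_meets (hN : 4 ≤ N) {k : ℕ} {types : List (List α)} {E : List (WEdge α)}
    (hγ : types.length + 1 ≤ N) (hk : 2 * k + 1 ≤ N) (hkγ : (2 * k + 1) ^ types.length ≤ N)
    (ht : ∀ U ∈ types, U.length ≤ N) (hE : E.length ≤ N) :
    Meets (basicT k types E) (N ^ 52030) fun o => ∀ M, o = some M → M.length ≤ N ^ 121 := by
  have hA : 4 ≤ N ^ 2 := four_le_pow hN (by norm_num)
  have hNA : N ≤ N ^ 2 := Nat.le_self_pow (by norm_num) N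
  have hB : 4 ≤ N ^ 120 := four_le_pow hN (by norm_num)
  have hB' : 4 ≤ N ^ 121 := four_le_pow hN (by norm_num)
  have h2 : N ^ 2 ≤ N ^ 120 := Nat.pow_le_pow_right (by omega) (by norm_num)
  have h4 : N ^ 4 + N ^ 120 ≤ N ^ 121 := pow_add_pow_le hN (by norm_num)
  rw [basicT]
  refine Meets.bindP hN (lengthT_meets hN (by omega)) fun γ hγ' => ?_
  subst hγ'
  refine Meets.bindP hN (flattenT_meets hN (by omega) ht) fun V hV => ?_
  have hVl : V.length ≤ N ^ 2 := by
    subst hV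
    exact (length_flatten_le (a := N) (by omega) ht).trans_eq (by ring)
  refine Meets.bindP hN (tuplesT_meets hN hγ hk hkγ) fun cs hcs => ?_
  refine (foldT_meets (p := 52010) hN (fun (_ : ℕ) (o : Option (List (WEdge α))) =>
    ∀ M, o = some M → M.length ≤ N ^ 121) (hcs.1.trans hkγ) (by simp)
    fun i c best _ _ hbest => ?_).mono_pow hN fun _ h => h
  refine Meets.bindP hN (typeConstrainedT_meets hN hγ ht hE) fun o ho => ?_
  cases o with
  | none => exact Meets.pure hbest
  | some M =>
    have hM := ho M rfl
    refine Meets.bindP hN (Meets.of_pow 120 6 (untouchedT_meets hB (hVl.trans h2) hM))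
      fun V₁ hV₁ => ?_
    refine Meets.bindP hN (Meets.of_pow 2 7 (inducedT_meets hA (hV₁.trans hVl)
      (hE.trans hNA))) fun E₁ hE₁ => ?_
    refine Meets.bindP hN (Meets.of_pow 2 410 (perfectMatchingT_meets hA (hV₁.trans hVl)
      (hE₁.1.trans (hE.trans hNA)))) fun o' ho' => ?_
    cases o' with
    | none => exact Meets.pure hbest
    | some M₁ =>
      have hM₁ : M₁.length ≤ N ^ 4 := (ho' M₁ rfl).trans_eq (by rw [← pow_mul])
      refine Meets.bindP hN (Meets.of_pow 121 8 (betterT_meets hB' (by omega) hbest))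
        fun b _ => Meets.ite (fun _ => ?_) fun _ => Meets.pure hbest
      refine Meets.bindP hN (Meets.of_pow 120 2 (appendT_meets hB hM)) fun R hR =>
        Meets.pure ?_
      rintro _ ⟨rfl⟩
      subst hR
      rw [List.length_append]
      omega

end Basic

/-! ### Loose separators -/

section Separator

variable {ι : Type} {N : ℕ}

/-- One way of distributing components with `t` vertices is kept for each size of the first side,
so there are at most `t + 1` of them. -/
theorem length_le_of_nodup_sizes {ways : List (ℕ × List ι × List ι)} {t : ℕ}
    (h : (ways.map Prod.fst).Nodup) (ht : ∀ x ∈ ways, x.1 ≤ t) : ways.length ≤ t + 1 := by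
  have hsub : ways.map Prod.fst ⊆ List.range (t + 1) := fun a ha => by
    obtain ⟨x, hx, rfl⟩ := List.mem_map.1 ha
    exact List.mem_range.2 (Nat.lt_succ_of_le (ht x hx))
  simpa using (h.subperm hsub).length_le

theorem splitsT_meets (hN : 4 ≤ N) {comps : List (List ι)} (hc : comps.length ≤ N)
    (hf : comps.flatten.length + 1 ≤ N) :
    Meets (splitsT comps) (N ^ 30) fun ways => ways.length ≤ N ∧
      ∀ x ∈ ways, x.2.1.length = x.1 ∧ x.1 + x.2.2.length = comps.flatten.length := by
  have hA : 4 ≤ N ^ 2 := four_le_pow hN (by norm_num)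
  have hNA : N + N ≤ N ^ 2 := by nlinarith
  refine Meets.pow_mul 2 15 ?_
  rw [splitsT]
  refine (foldT_meets_prefix (p := 12) hA
    (fun (pre : List (List ι)) (ways : List (ℕ × List ι × List ι)) =>
      (ways.map Prod.fst).Nodup ∧
      ∀ x ∈ ways, x.2.1.length = x.1 ∧ x.1 + x.2.2.length = pre.flatten.length) (by omega)
      (by simp) fun pre K post ways hpre hways => ?_).mono_pow hA fun ways h =>
        ⟨(length_le_of_nodup_sizes h.1 (t := comps.flatten.length)
          fun x hx => by have := h.2 x hx; omega).trans hf, h.2⟩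
  have hflat : pre.flatten.length + K.length + 1 ≤ N := by
    rw [hpre, List.flatten_append, List.flatten_cons, List.length_append,
      List.length_append] at hf
    omega
  have hpreK : (pre ++ [K]).flatten.length = pre.flatten.length + K.length := by simp
  have hwl : ways.length ≤ N := (length_le_of_nodup_sizes hways.1
    (t := pre.flatten.length) fun x hx => by have := hways.2 x hx; omega).trans (by omega)
  let Q : ℕ × List ι × List ι → Prop := fun x =>
    x.2.1.length = x.1 ∧ x.1 + x.2.2.length = (pre ++ [K]).flatten.length
  refine Meets.bindP hA (lengthT_meets hA (by omega)) fun s hs => ?_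
  refine Meets.bindP hA (mapT_meets (p := 3) (Q := Q) hA (by omega) fun x hx =>
    (appendT_meets hA (by omega)).bindP hA fun R hR => Meets.pure ?_) fun right hr => ?_
  · subst hR
    have := hways.2 x hx
    refine ⟨this.1, ?_⟩
    simp only [List.length_append, hpreK]
    omega
  refine Meets.bindP hA (mapT_meets (p := 3) (Q := Q) hA (by omega) fun x hx =>
    (appendT_meets hA (by omega)).bindP hA fun R hR => Meets.pure ?_) fun left hl => ?_
  · subst hR
    have := hways.2 x hx
    refine ⟨?_, ?_⟩
    · simp only [List.length_append]
      omega
    · simp only [hpreK]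
      omega
  refine Meets.bindP hA (appendT_meets hA (by omega)) fun all hall => ?_
  have hQ : ∀ x ∈ all, Q x := fun x hx => by
    subst hall
    rcases List.mem_append.1 hx with h | h
    · exact hr.2 x h
    · exact hl.2 x h
  refine (foldT_meets (p := 4) hA (fun (_ : ℕ) (kept : List (ℕ × List ι × List ι)) =>
    (kept.map Prod.fst).Nodup ∧ ∀ x ∈ kept, Q x) ?_ (by simp)
    fun i x kept _ hx hk => ?_).mono_pow hA fun _ h => h
  · subst hall
    rw [List.length_append]
    omega
  have hkl : kept.length ≤ N := (length_le_of_nodup_sizes hk.1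
    (t := pre.flatten.length + K.length) fun y hy => by
      have := (hk.2 y hy).2
      omega).trans (by omega)
  refine Meets.bindP hA (P := fun b => b = kept.any fun t => decide (t.1 = x.1))
    ⟨(anyT_meets (p := 0) (P := fun _ _ => True) hA (by omega) fun _ _ => Meets.pure_true).1,
      anyT_pure_val _ _⟩ fun b hb => Meets.pure ?_
  subst hb
  split
  · exact hk
  · rename_i hany
    refine ⟨?_, fun y hy => ?_⟩
    · rw [List.map_cons, List.nodup_cons]
      refine ⟨fun hmem => hany ?_, hk.1⟩
      obtain ⟨y, hy, hyx⟩ := List.mem_map.1 hmem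
      exact List.any_eq_true.2 ⟨y, hy, by simpa using hyx⟩
    · rcases List.mem_cons.1 hy with rfl | hy
      · exact hQ _ hx
      · exact hk.2 y hy

variable [DecidableEq ι]

theorem looseSeparatorT_meets (hN : 4 ≤ N) {φ : ℕ} {V : List ι} {E T : List (ι × ι)}
    (hV : V.length + 1 ≤ N) (hE : E.length ≤ N) (hT : T.length ≤ N) (hφ : φ ≤ N)
    (hVφ : (V.length + 1) ^ φ ≤ N) :
    Meets (looseSeparatorT φ V E T) (N ^ 80) fun o => ∀ S P₁ P₂, o = some (S, P₁, P₂) →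
      S.length ≤ φ ∧ 4 * P₁.length ≤ 3 * V.length ∧ 4 * P₂.length ≤ 3 * V.length := by
  have hA : 4 ≤ N ^ 2 := four_le_pow hN (by norm_num)
  have hNA : N + N ≤ N ^ 2 := by nlinarith
  rw [looseSeparatorT]
  refine Meets.bindP hN (lengthT_meets hN (by omega)) fun size hs => ?_
  refine Meets.bindP hN (subsetsT_meets hN hV hVφ) fun candidates hc => ?_
  refine (foldT_meets (p := 70) hN
    (fun (_ : ℕ) (o : Option (List ι × List ι × List ι)) => ∀ S P₁ P₂, o = some (S, P₁, P₂) →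
      S.length ≤ φ ∧ 4 * P₁.length ≤ 3 * V.length ∧ 4 * P₂.length ≤ 3 * V.length)
    (hc.1.trans hVφ) (by simp) fun i S found _ hS hfound => ?_).mono_pow hN fun _ h => h
  have hSφ := hc.2 S hS
  cases found with
  | some r => exact Meets.pure hfound
  | none =>
    refine Meets.bindP hN (anyT_meets (p := 3) hN (hSφ.trans hφ) fun x _ =>
      coversT_meets hN hT) fun b _ => Meets.ite (fun _ => Meets.pure (by simp)) fun _ => ?_
    refine Meets.bindP hN (filterT_meets_length (p := 4) hN (by omega) fun v _ =>
      (elemT_meets hN (by omega)).bindP hN fun _ _ => Meets.pure_true) fun V₁ hV₁ => ?_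
    refine Meets.bindP hN (filterT_meets_length (p := 5) hN hE fun e _ =>
      (elemT_meets hN (by omega)).bindP hN fun _ _ => (elemT_meets hN (by omega)).bindP hN
      fun _ _ => Meets.pure_true) fun E₁ hE₁ => ?_
    refine Meets.bindP hN (componentsT_meets hN (by omega) (by omega)) fun comps hcomps => ?_
    refine Meets.bindP hN (Meets.of_pow 2 30 (splitsT_meets hA (by omega) (by omega)))
      fun ways hways => ?_
    refine Meets.bindP hN (lengthT_meets hN (by omega)) fun rest hrest => ?_
    refine Meets.bindP hN (Meets.of_pow 2 2 (findT_meets (p := 0)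
      (P := fun (x : ℕ × List ι × List ι) b => b = decide (size ≤ 4 * x.1 ∧
        4 * x.1 ≤ 3 * size ∧ size ≤ 4 * (rest - x.1) ∧ 4 * (rest - x.1) ≤ 3 * size))
      hA hways.1 fun _ _ => Meets.pure rfl)) fun o ho => Meets.pure ?_
    intro S' P₁ P₂ h
    obtain ⟨x, rfl, hx⟩ := Option.map_eq_some_iff.1 h
    cases hx
    obtain ⟨hxw, hxp⟩ := ho x rfl
    have h1 := hways.2 x hxw
    have h2 := of_decide_eq_true hxp.symm
    refine ⟨hSφ, ?_, ?_⟩ <;> omega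

end Separator

/-! ### The steps of one recursive call -/

theorem length_filter_or_le {α : Type} (p q : α → Bool) (l : List α) :
    (l.filter fun a => p a || q a).length ≤ (l.filter p).length + (l.filter q).length := by
  induction l with
  | nil => simp
  | cons a l ih =>
    simp only [List.filter_cons]
    cases p a <;> cases q a <;> simp <;> omega

section Steps

variable {α ι : Type} [DecidableEq ι] {N : ℕ}

theorem blobsT_meets (hN : 4 ≤ N) {β : α → ι} {V : List ι} {X : List α} (hV : V.length ≤ N)
    (hX : X.length ≤ N) :
    Meets (blobsT β V X) (N ^ 4) fun r => r.length = V.length ∧ ∀ U ∈ r, U.length ≤ N :=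
  mapT_meets (p := 2) (Q := fun U : List α => U.length ≤ N) hN hV fun _ _ =>
    (filterT_meets_length (p := 0) hN hX fun _ _ => Meets.pure_true).mono le_rfl
      fun _ h => h.1.trans hX

/-- There are at most `Z ^ b` selections of edges from `b` bands, if `Z` bounds the number of
sets of at most `r` edges. -/
theorem selectionsT_meets (hN : 4 ≤ N) {β : α → ι} {E : List (WEdge α)} {r : ℕ}
    {bands : List (ι × ι)} (hE : E.length + 1 ≤ N) (hr : r ≤ N) (hb : bands.length ≤ N)
    (hZ : ((E.length + 1) ^ r) ^ bands.length ≤ N) :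
    Meets (selectionsT β E r bands) (N ^ 20) fun sets => sets.length ≤ N ∧
      ∀ s ∈ sets, s.length ≤ bands.length * r := by
  set Z := (E.length + 1) ^ r with hZdef
  have hZ1 : 1 ≤ Z := Nat.one_le_pow _ _ (Nat.succ_pos _)
  rw [selectionsT]
  refine (foldT_meets (p := 15) hN (fun (i : ℕ) (sets : List (List (WEdge α))) =>
    sets.length ≤ Z ^ i ∧ ∀ s ∈ sets, s.length ≤ i * r) hb (by simp)
    fun i B sets hi _ hsets => ?_).mono_pow hN fun sets h => ⟨h.1.trans hZ, h.2⟩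
  have hZN : Z ≤ N := le_trans (Nat.le_self_pow (by omega) Z) hZ
  have hiN : Z ^ i ≤ N := (Nat.pow_le_pow_right hZ1 hi.le).trans hZ
  refine Meets.bindP hN (filterT_meets_length (p := 0) hN (by omega) fun _ _ =>
    Meets.pure_true) fun EB hEB => ?_
  have hEBZ : (EB.length + 1) ^ r ≤ Z := Nat.pow_le_pow_left (by omega) r
  refine Meets.bindP hN (subsetsT_meets hN (by omega) (hEBZ.trans hZN)) fun subs hsubs => ?_
  refine Meets.bindP hN (mapT_meets (p := 4) (Q := fun l : List (List (WEdge α)) =>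
    l.length ≤ Z ∧ ∀ x ∈ l, x.length ≤ (i + 1) * r) hN (hsets.1.trans hiN) fun s hs =>
    (mapT_meets (p := 2) (Q := fun x : List (WEdge α) => x.length ≤ (i + 1) * r) hN
      (hsubs.1.trans (hEBZ.trans hZN)) fun t ht =>
      (appendT_meets hN ((hsubs.2 t ht).trans hr)).mono le_rfl fun x hx => by
        subst hx
        have h1 := hsets.2 s hs
        have h2 := hsubs.2 t ht
        rw [List.length_append, add_mul, one_mul]
        omega).mono le_rfl fun l hl => ⟨hl.1.le.trans (hsubs.1.trans hEBZ), hl.2⟩)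
    fun l hl => ?_
  refine (flattenT_meets hN (by omega) fun x hx => (hl.2 x hx).1.trans hZN).mono_pow hN
    fun R hR => ?_
  subst hR
  refine ⟨?_, fun x hx => ?_⟩
  · rw [pow_succ]
    exact length_flatten_le (hl.1.le.trans hsets.1) fun x hx => (hl.2 x hx).1
  · obtain ⟨y, hy, hxy⟩ := List.mem_flatten.1 hx
    exact (hl.2 y hy).2 x hxy

theorem inducedBandsT_meets (hN : 4 ≤ N) {V : List ι} {E : List (ι × ι)} (hV : V.length ≤ N)
    (hE : E.length ≤ N) : Meets (inducedBandsT V E) (N ^ 7) fun r => r.Sublist E :=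
  (filterT_meets (p := 5) hN hE fun _ _ => (elemT_meets hN hV).bindP hN fun _ _ =>
    (elemT_meets hN hV).bindP hN fun _ _ => Meets.pure_true).mono le_rfl fun r hr => by
      subst hr
      exact List.filter_sublist

theorem length_filter_touching_le {E : List (ι × ι)} {d : ℕ}
    (hd : ∀ b, (E.filter fun e => e.1 = b ∨ e.2 = b).length ≤ d) (S : List ι) :
    (E.filter fun e => decide (e.1 ∈ S) || decide (e.2 ∈ S)).length ≤ S.length * d := by
  induction S with
  | nil => simp
  | cons b S ih =>
    have h : ∀ e ∈ E, (decide (e.1 ∈ b :: S) || decide (e.2 ∈ b :: S)) =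
        ((decide (e.1 = b ∨ e.2 = b)) || (decide (e.1 ∈ S) || decide (e.2 ∈ S))) := by
      intro e _
      rw [Bool.eq_iff_iff]
      simp only [List.mem_cons, Bool.or_eq_true, decide_eq_true_eq]
      tauto
    rw [List.filter_congr h, List.length_cons, add_mul, one_mul]
    have hb := hd b
    have := length_filter_or_le (fun e => decide (e.1 = b ∨ e.2 = b))
      (fun e => decide (e.1 ∈ S) || decide (e.2 ∈ S)) E
    omega

theorem isMatchingT_meets [DecidableEq α] (hN : 4 ≤ N) : ∀ M : List (WEdge α), M.length ≤ N →
    Meets (isMatchingT M) ((M.length + 1) * N ^ 6) fun _ => True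
  | [], _ => by
    rw [isMatchingT]
    exact Meets.tick_pure (by positivity) trivial
  | e :: M, h => by
    rw [isMatchingT]
    simp only [List.length_cons] at h ⊢
    exact Meets.round (Meets.tickT hN (Meets.bindT hN (touchesT_meets hN (by omega)) fun _ _ =>
      Meets.bindT hN (touchesT_meets hN (by omega)) fun _ _ => Meets.ite
      (fun _ => Meets.pure_true) fun _ => (isMatchingT_meets hN M (by omega)).tail))

theorem extendsT_meets [DecidableEq α] (hN : 4 ≤ N) {V : List α} {E M : List (WEdge α)}
    (hV : V.length ≤ N) (hE : E.length ≤ N) (hM : M.length + 1 ≤ N) :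
    Meets (extendsT V E M) (N ^ 420) fun _ => True := by
  rw [extendsT]
  refine Meets.bindP hN ((isMatchingT_meets hN M (by omega)).rounds hM) fun _ _ =>
    Meets.ite (fun _ => ?_) fun _ => Meets.pure_true
  exact Meets.bindP hN (untouchedT_meets hN hV (by omega)) fun V₁ hV₁ =>
    Meets.bindP hN (inducedT_meets hN (by omega) hE) fun E₁ hE₁ =>
    Meets.bindP hN (p := 416) ((perfectMatchingT_meets hN (by omega) (by omega)))
      fun _ _ => Meets.pure_true

end Steps

/-! ### The recursion -/

section Recursion

variable {α ι : Type} [DecidableEq α] [DecidableEq ι]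

/-- The sizes of an input of the recursive algorithm: `W` bounds the lengths of the lists, `d` the
number of bands at one blob, and `t` the number of tight bands. -/
structure SizeBounds (W d t : ℕ) (PV : List ι) (PE : List (ι × ι)) (GV : List α)
    (GE : List (WEdge α)) (T : List (ι × ι)) : Prop where
  blobs : PV.length + 1 ≤ W
  bands : PE.length ≤ W
  degree : ∀ b, (PE.filter fun e => e.1 = b ∨ e.2 = b).length ≤ d
  vertices : GV.length ≤ W
  edges : GE.length + 1 ≤ W
  tight : T.length ≤ t

/-- In the base case with many tight bands the number of blobs is `O(φ √n)`. -/
theorem blobs_le_of_floor_le {φ b t r : ℕ} (hφ : 1 ≤ φ) (htr : t ≤ r)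
    (h : ⌊((b : ℚ) / 2 - 3) / (φ : ℚ)⌋ ≤ 2 * (t : ℤ)) : b ≤ 12 * φ * (r + 1) := by
  have hφ' : (0 : ℚ) < φ := by exact_mod_cast hφ
  rw [Int.floor_le_iff, div_lt_iff₀ hφ'] at h
  have h2 : (b : ℚ) < 2 * φ * (2 * t + 1) + 6 := by push_cast at h; linarith
  have h3 : b < 2 * φ * (2 * t + 1) + 6 := by exact_mod_cast h2
  nlinarith [Nat.mul_le_mul_left φ htr]

/-- A prototype with at most one blob belongs to the base case. -/
theorem floor_le_of_blobs_le_one {φ b t : ℕ} (hφ : 1 ≤ φ) (hb : b ≤ 1) :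
    ⌊((b : ℚ) / 2 - 3) / (φ : ℚ)⌋ ≤ 2 * (t : ℤ) := by
  have hφ' : (0 : ℚ) < φ := by exact_mod_cast hφ
  have hb' : (b : ℚ) ≤ 1 := by exact_mod_cast hb
  have ht : (0 : ℚ) ≤ t := by positivity
  rw [Int.floor_le_iff, div_lt_iff₀ hφ']
  push_cast
  nlinarith [mul_nonneg ht hφ'.le]

/-- All numbers of choices in a call are bounded by `X = W ^ D`. Both parts of a
separated prototype have at most three quarters of the blobs, so the recursion has depth at most
`L` if the prototype has at most `(4 / 3) ^ L` blobs; each level contributes a bounded power of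
`X`. -/
theorem bbbT_meets {C φ n W D : ℕ} {β : α → ι} (hφ : 1 ≤ φ) (hW : 4 ≤ W) (hn : n + 1 ≤ W)
    (hD₁ : C + 12 * φ * (n.sqrt + 1) ≤ D) (hD₂ : φ * (3 * φ) * n.sqrt ≤ D) :
    ∀ (L depth k : ℕ) (PV : List ι) (PE : List (ι × ι)) (GV : List α) (GE : List (WEdge α))
      (T : List (ι × ι)), SizeBounds W (3 * φ) n.sqrt PV PE GV GE T → 2 * k + 1 ≤ W →
      PV.length * 3 ^ L ≤ 4 ^ L →
      Meets (bbbT C φ n β depth k PV PE GV GE T) ((W ^ D) ^ (60000 * (L + 1)))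
        fun o => ∀ M, o = some M → M.length ≤ (W ^ D) ^ (122 + L) := by
  have hφD : 12 * φ ≤ D := by nlinarith [Nat.zero_le (φ * n.sqrt)]
  set X := W ^ D with hX
  have hWX : W ≤ X := Nat.le_self_pow (by omega) W
  have hX4 : 4 ≤ X := hW.trans hWX
  have hpow : ∀ {a e : ℕ}, a ≤ W → e ≤ D → a ^ e ≤ X := fun {a e} ha he =>
    (Nat.pow_le_pow_left ha e).trans (Nat.pow_le_pow_right (by omega) he)
  have hDX : D ≤ X := (Nat.lt_pow_self (by omega)).le
  have hbase : ∀ {k : ℕ} {PV : List ι} {PE : List (ι × ι)} {GV : List α} {GE : List (WEdge α)}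
      {T : List (ι × ι)}, SizeBounds W (3 * φ) n.sqrt PV PE GV GE T → 2 * k + 1 ≤ W →
      ⌊((PV.length : ℚ) / 2 - 3) / (φ : ℚ)⌋ ≤ 2 * (T.length : ℤ) ∨ PV.length ≤ C →
      Meets (do let types ← blobsT β PV GV; basicT k types GE) (X ^ 52031)
        fun o => ∀ M, o = some M → M.length ≤ X ^ 121 := by
    intro k PV PE GV GE T hI hk hcond
    have hb : PV.length ≤ D := by
      rcases hcond with h | h
      · have := blobs_le_of_floor_le hφ hI.tight h
        omega
      · omega
    refine Meets.bindP hX4 (blobsT_meets hX4 (by have := hI.blobs; omega)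
      (hI.vertices.trans hWX)) fun types ht => ?_
    have h1 := hI.blobs
    have h2 := hI.edges
    exact basicT_meets hX4 (by omega) (by omega) (by rw [ht.1]; exact hpow hk hb) ht.2 (by omega)
  intro L
  induction L with
  | zero =>
    intro depth k PV PE GV GE T hI hk hL
    cases depth with
    | zero =>
      rw [bbbT]
      exact Meets.tick_pure (by positivity) (by simp)
    | succ depth =>
      have hPM := perfectMatchingT_meets hX4 (hI.vertices.trans hWX)
        ((Nat.le_of_succ_le hI.edges).trans hWX)
      rw [bbbT, show 60000 * (0 + 1) = 59999 + 1 from rfl]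
      refine Meets.tickP hX4 (Meets.bindP hX4 hPM fun o _ => ?_)
      cases o with
      | none => exact Meets.pure (by simp)
      | some M₀ =>
        refine Meets.bindP hX4 (lengthT_meets hX4 (by have := hI.blobs; omega)) fun blobs hb => ?_
        refine Meets.bindP hX4 (lengthT_meets hX4 (by
          have := hI.tight; have := Nat.sqrt_le_self n; omega)) fun tight ht => ?_
        subst hb ht
        refine Meets.ite (fun hc => (hbase hI hk hc).mono_pow hX4 fun o ho M hM => ?_)
          fun hc => ?_
        · exact (ho M hM).trans (Nat.pow_le_pow_right (by omega) (by norm_num))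
        · exact absurd (Or.inl (floor_le_of_blobs_le_one hφ (by simpa using hL))) hc
  | succ L ih =>
    intro depth k PV PE GV GE T hI hk hL
    cases depth with
    | zero =>
      rw [bbbT]
      exact Meets.tick_pure (by positivity) (by simp)
    | succ depth =>
      have hPM := perfectMatchingT_meets hX4 (hI.vertices.trans hWX)
        ((Nat.le_of_succ_le hI.edges).trans hWX)
      have hPV := hI.blobs
      have hPE := hI.bands
      have hGV := hI.vertices
      have hGE := hI.edges
      have hT : T.length ≤ W := by
        have := hI.tight
        have := Nat.sqrt_le_self n
        omega
      -- the exponent of the budget of a recursive call, as an atom for `omega`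
      obtain ⟨e, he⟩ : ∃ e, e = 60000 * (L + 1) := ⟨_, rfl⟩
      rw [bbbT, show 60000 * (L + 1 + 1) = e + 60000 by omega]
      -- `Y` bounds the lengths of the solutions; the last tests of a round have it as size parameter
      set Y := X ^ (122 + (L + 1)) with hY
      have hXY : X ≤ Y := Nat.le_self_pow (by omega) X
      have hY4 : 4 ≤ Y := hX4.trans hXY
      have h121 : X ^ 121 ≤ X ^ (122 + L) := Nat.pow_le_pow_right (by omega) (by omega)
      have h1L : X ≤ X ^ (122 + L) := Nat.le_self_pow (by omega) X
      have hYL : 4 * X ^ (122 + L) ≤ Y := by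
        rw [hY, ← add_assoc, pow_succ, mul_comm]
        exact Nat.mul_le_mul_left _ hX4
      refine Meets.tickP hX4 (Meets.bindP hX4 hPM fun o _ => ?_)
      cases o with
      | none => exact Meets.pure (by simp)
      | some M₀ =>
        refine Meets.bindP hX4 (lengthT_meets hX4 (by omega)) fun blobs hb => ?_
        refine Meets.bindP hX4 (lengthT_meets hX4 (by omega)) fun tight ht => ?_
        subst hb ht
        refine Meets.ite (fun hc => (hbase hI hk hc).mono_pow hX4 fun o ho M hM => ?_)
          fun _ => ?_
        · exact (ho M hM).trans (h121.trans (by omega))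
        refine Meets.bindP hX4 (looseSeparatorT_meets hX4 (by omega) (by omega) (by omega)
          (by omega) (hpow hPV (by omega))) fun o ho => ?_
        rcases o with _ | ⟨S, P₁, P₂⟩
        · exact Meets.pure (by simp)
        obtain ⟨hS, hP₁, hP₂⟩ := ho S P₁ P₂ rfl
        have hSX : S.length ≤ X := by omega
        have hP₁L : P₁.length * 3 ^ L ≤ 4 ^ L := by
          have := Nat.mul_le_mul_right (3 ^ L) hP₁
          rw [pow_succ, pow_succ] at hL
          linarith
        have hP₂L : P₂.length * 3 ^ L ≤ 4 ^ L := by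
          have := Nat.mul_le_mul_right (3 ^ L) hP₂
          rw [pow_succ, pow_succ] at hL
          linarith
        refine Meets.bindP hX4 (filterT_meets (p := 5) hX4 (by omega) fun B _ =>
          (elemT_meets hX4 hSX).bindP hX4 fun _ _ => (elemT_meets hX4 hSX).bindP hX4 fun _ _ =>
          Meets.pure_true) fun bands hbands => ?_
        -- the separator has at most `φ` blobs with at most `3 * φ` bands each
        have hbl : bands.length ≤ φ * (3 * φ) := by
          have h := length_filter_touching_le hI.degree S
          subst hbands
          refine le_trans (le_of_eq ?_) (h.trans (Nat.mul_le_mul_right _ hS))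
          congr 2
          funext B
          change ((elemT B.1 S).val || (elemT B.2 S).val) = _
          rw [elemT_val, elemT_val]
        have hbW : bands.length ≤ X := by
          subst hbands
          exact (List.length_filter_le _ _).trans (hPE.trans hWX)
        refine Meets.bindP hX4 (sqrtT_meets hX4 (by omega)) fun r hr => ?_
        have hbr : bands.length * r ≤ D := (Nat.mul_le_mul hbl hr).trans hD₂
        refine Meets.bindP hX4 (selectionsT_meets hX4 (by omega)
          (by have := Nat.sqrt_le_self n; omega) hbW
          (by rw [← pow_mul, mul_comm]; exact hpow hGE hbr)) fun selections hsel => ?_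
        refine Meets.bindP hX4 (tuplesT_meets hX4 (g := 4) (s := k) ?_ (by omega)
          (hpow (by omega) (by omega))) fun quadruples hquad => ?_
        · have : 12 ≤ D := by omega
          omega
        refine Meets.bindP hX4 (filterT_meets_length (p := 3) hX4 (by omega) fun _ _ =>
          elemT_meets hX4 hSX) fun VS hVS => ?_
        refine Meets.bindP hX4 (inducedBandsT_meets hX4 (by omega) (by omega)) fun PE₁ hPE₁ => ?_
        refine Meets.bindP hX4 (inducedBandsT_meets hX4 (by omega) (by omega)) fun PE₂ hPE₂ => ?_
        refine Meets.bindP hX4 (inducedBandsT_meets hX4 (by omega) (by omega)) fun T₁ hT₁ => ?_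
        refine Meets.bindP hX4 (inducedBandsT_meets hX4 (by omega) (by omega)) fun T₂ hT₂ => ?_
        refine (foldT_meets (p := e + 59000) hX4 (fun (_ : ℕ) (o : Option (List (WEdge α))) =>
          ∀ M, o = some M → M.length ≤ Y) hsel.1 (by simp)
          fun _ E' best₀ _ hE' hbest₀ => ?_).mono_pow hX4 fun _ h => h
        refine (foldT_meets (p := e + 58000) hX4 (fun (_ : ℕ) (o : Option (List (WEdge α))) =>
          ∀ M, o = some M → M.length ≤ Y) (hquad.1.trans (hpow (by omega) (by omega))) hbest₀
          fun _ q best _ hq hbest => ?_).mono_pow hX4 fun _ h => h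
        have hE'X : E'.length ≤ X := by
          have := hsel.2 E' hE'
          omega
        have hqk := hquad.2 q hq
        match q with
        | [] | [_] | [_, _] | [_, _, _] | _ :: _ :: _ :: _ :: _ :: _ => exact Meets.pure hbest
        | [k₀, kblobs, k₁, k₂] =>
          have hk₀ := hqk kblobs (by simp)
          have hk₁ := hqk k₁ (by simp)
          have hk₂ := hqk k₂ (by simp)
          refine Meets.bindP hX4 (untouchedT_meets hX4 (by omega) hE'X) fun free hfree => ?_
          refine Meets.bindP hX4 (filterT_meets_length (p := 3) hX4 (by omega) fun _ _ =>
            elemT_meets hX4 (by omega)) fun V₁ hV₁ => ?_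
          refine Meets.bindP hX4 (filterT_meets_length (p := 3) hX4 (by omega) fun _ _ =>
            elemT_meets hX4 (by omega)) fun V₂ hV₂ => ?_
          refine Meets.bindP hX4 (inducedT_meets hX4 (by omega) (by omega)) fun E₁ hE₁ => ?_
          refine Meets.bindP hX4 (inducedT_meets hX4 (by omega) (by omega)) fun E₂ hE₂ => ?_
          refine Meets.bindP hX4 (ih depth k₁ P₁ PE₁ V₁ E₁ T₁
            ⟨by omega, hPE₁.length_le.trans hPE, fun b =>
              (hPE₁.filter _).length_le.trans (hI.degree b), by omega, by omega,
              hT₁.length_le.trans hI.tight⟩ (by omega) hP₁L) fun R₁ hR₁ => ?_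
          refine Meets.bindP hX4 (ih depth k₂ P₂ PE₂ V₂ E₂ T₂
            ⟨by omega, hPE₂.length_le.trans hPE, fun b =>
              (hPE₂.filter _).length_le.trans (hI.degree b), by omega, by omega,
              hT₂.length_le.trans hI.tight⟩ (by omega) hP₂L) fun R₂ hR₂ => ?_
          rcases R₁ with _ | M₁
          · exact Meets.pure hbest
          rcases R₂ with _ | M₂
          · exact Meets.pure hbest
          have hM₁ := hR₁ M₁ rfl
          have hM₂ := hR₂ M₂ rfl
          refine Meets.bindP hX4 (Meets.of_pow _ 2 (appendT_meets hY4 (r := M₂)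
            (by omega : M₁.length ≤ Y))) fun M₁₂ hM₁₂ => ?_
          refine Meets.bindP hX4 (appendT_meets hX4 hE'X) fun M' hM' => ?_
          have hM'l : M'.length ≤ X + 2 * X ^ (122 + L) := by
            subst hM' hM₁₂
            simp only [List.length_append]
            omega
          refine Meets.bindP hX4 (Meets.of_pow _ 420 (extendsT_meets hY4 (by omega)
            (by omega) (by omega))) fun _ _ => Meets.ite (fun _ => ?_) fun _ => Meets.pure hbest
          refine Meets.bindP hX4 (untouchedT_meets hX4 (by omega) hE'X) fun VB hVB => ?_
          refine Meets.bindP hX4 (blobsT_meets hX4 hSX (by omega)) fun typesB htB => ?_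
          refine Meets.bindP hX4 (inducedT_meets hX4 (by omega) (by omega)) fun EB₀ hEB₀ => ?_
          refine Meets.bindP hX4 (filterT_meets_length (p := 0) hX4 (by omega) fun _ _ =>
            Meets.pure_true) fun EB hEB => ?_
          refine Meets.bindP hX4 (basicT_meets hX4 (by omega) (by omega)
            (by rw [htB.1]; exact hpow (by omega) (by omega)) htB.2 (by omega)) fun o ho => ?_
          rcases o with _ | MB
          · exact Meets.pure hbest
          have hMB := ho MB rfl
          refine Meets.bindP hX4 (Meets.of_pow _ 2 (appendT_meets hY4 (r := MB)
            (by omega : M'.length ≤ Y))) fun M'' hM'' => ?_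
          have hM''l : M''.length ≤ Y := by
            subst hM''
            rw [List.length_append]
            omega
          refine Meets.bindP hX4 (Meets.of_pow _ 8
            (betterT_meets hY4 hM''l hbest)) fun _ _ => Meets.ite (fun _ => Meets.pure ?_)
            fun _ => Meets.pure hbest
          rintro _ ⟨rfl⟩
          exact hM''l

end Recursion

/-! ### Sizes of blow-ups -/

namespace BlowUp

variable {m N : ℕ}

theorem mem_pairs {e : Fin N × Fin N} : e ∈ pairs N ↔ e.1 < e.2 := by
  obtain ⟨i, j⟩ := e
  simp [pairs]

theorem pairs_nodup (N : ℕ) : (pairs N).Nodup := by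
  refine List.nodup_flatMap.2 ⟨fun i _ => ?_, ?_⟩
  · exact ((List.nodup_finRange N).filter _).map fun a b h => (Prod.mk.inj h).2
  · refine (List.nodup_finRange N).imp fun {i j} hij => ?_
    intro e hi hj
    obtain ⟨a, _, rfl⟩ := List.mem_map.1 hi
    obtain ⟨b, _, hb⟩ := List.mem_map.1 hj
    exact hij (Prod.mk.inj hb).1.symm

theorem length_pairs_le (N : ℕ) : (pairs N).length ≤ N * N := by
  simpa using (pairs_nodup N).length_le_card

theorem bandList_nodup (I : BlowUp m N) : I.bandList.Nodup := (pairs_nodup m).filter _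

theorem lt_and_adj_of_mem_bandList {I : BlowUp m N} {e : Fin m × Fin m} (h : e ∈ I.bandList) :
    e.1 < e.2 ∧ I.prototype.Adj e.1 e.2 := by
  have h' := List.mem_filter.1 h
  exact ⟨mem_pairs.1 h'.1, by simpa using h'.2⟩

theorem length_edgeList_le (I : BlowUp m N) : I.edgeList.length ≤ N * N := by
  rw [edgeList, List.length_map]
  exact (List.length_filter_le _ _).trans (length_pairs_le N)

theorem length_bandList_le (I : BlowUp m N) : I.bandList.length ≤ m * m :=
  (List.length_filter_le _ _).trans (length_pairs_le m)

theorem blobs_le (I : BlowUp m N) : m ≤ N := by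
  simpa using Fintype.card_le_of_surjective I.blob I.blob_surjective

end BlowUp

/-- The bandwidth is attained by some ordering. -/
theorem exists_bandwidth_ordering {V : Type} [Fintype V] (G : SimpleGraph V) :
    ∃ σ : V ≃ Fin (Fintype.card V), ∀ u v, G.Adj u v →
      |((σ u : ℕ) : ℤ) - ((σ v : ℕ) : ℤ)| ≤ bandwidth G := by
  refine Nat.sInf_mem (s := {b : ℕ | ∃ σ : V ≃ Fin (Fintype.card V), ∀ u v, G.Adj u v →
    |((σ u : ℕ) : ℤ) - ((σ v : ℕ) : ℤ)| ≤ b})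
    ⟨Fintype.card V, Fintype.equivFin V, fun u v _ => ?_⟩
  have hu := (Fintype.equivFin V u).isLt
  have hv := (Fintype.equivFin V v).isLt
  rw [abs_le]
  constructor <;> omega

namespace BlowUp

variable {m N : ℕ}

/-- In an ordering of bandwidth at most `φ` the neighbours of a blob are at most `φ` positions away.
A band at the blob `b` is determined by the sum of the positions of its ends, because bands are
listed as increasing pairs. -/
theorem length_bands_at_le (I : BlowUp m N) {φ : ℕ} (hφ : bandwidth I.prototype ≤ φ)
    (b : Fin m) : (I.bandList.filter fun e => e.1 = b ∨ e.2 = b).length ≤ 2 * φ + 1 := by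
  obtain ⟨σ, hσ⟩ := exists_bandwidth_ordering I.prototype
  let pos : Fin m → ℤ := fun u => ((σ u : ℕ) : ℤ)
  have hpos : Function.Injective pos := fun u v h =>
    σ.injective (Fin.ext (Nat.cast_injective (R := ℤ) h))
  -- one end of the bands considered is `b`, so the sum of the positions determines the other one
  let f : Fin m × Fin m → ℤ := fun e => pos e.1 + pos e.2
  have hmem : ∀ e ∈ I.bandList.filter (fun e => e.1 = b ∨ e.2 = b),
      e.1 < e.2 ∧ I.prototype.Adj e.1 e.2 ∧ (e.1 = b ∨ e.2 = b) := fun e he => by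
    have h := List.mem_filter.1 he
    exact ⟨(lt_and_adj_of_mem_bandList h.1).1, (lt_and_adj_of_mem_bandList h.1).2,
      by simpa using h.2⟩
  have hnd : ((I.bandList.filter fun e => e.1 = b ∨ e.2 = b).map f).Nodup := by
    refine (I.bandList_nodup.filter _).map_on fun e he e' he' h => ?_
    obtain ⟨i, j⟩ := e
    obtain ⟨i', j'⟩ := e'
    obtain ⟨h1, -, h2⟩ := hmem _ he
    obtain ⟨h1', -, h2'⟩ := hmem _ he'
    simp only [f] at h h1 h2 h1' h2'
    rcases h2 with rfl | rfl <;> rcases h2' with rfl | rfl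
    · rw [hpos (add_left_cancel h)]
    · have := hpos (add_left_cancel (h.trans (add_comm _ _)))
      subst this
      exact absurd h1 h1'.not_gt
    · have := hpos (add_left_cancel ((add_comm _ _).trans h))
      subst this
      exact absurd h1 h1'.not_gt
    · rw [hpos (add_right_cancel h)]
  have hsub : ((I.bandList.filter fun e => e.1 = b ∨ e.2 = b).map f).toFinset ⊆
      Finset.Icc (2 * pos b - φ) (2 * pos b + φ) := fun z hz => by
    obtain ⟨e, he, rfl⟩ := List.mem_map.1 (List.mem_toFinset.1 hz)
    obtain ⟨-, hadj, hb⟩ := hmem e he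
    have h := abs_le.1 (hσ _ _ hadj)
    rw [Finset.mem_Icc]
    simp only [f, pos]
    rcases hb with rfl | rfl <;> constructor <;> omega
  have hcard := Finset.card_le_card hsub
  rw [List.toFinset_card_of_nodup hnd, List.length_map, Int.card_Icc] at hcard
  omega

theorem length_tight_le (I : BlowUp m N) (T : Finset (Sym2 (Fin m))) :
    (I.bandList.filter fun p => s(p.1, p.2) ∈ T).length ≤ T.card := by
  have hnd : ((I.bandList.filter fun p => s(p.1, p.2) ∈ T).map fun p => s(p.1, p.2)).Nodup := by
    refine (I.bandList_nodup.filter _).map_on fun e he e' he' h => ?_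
    have h1 := (lt_and_adj_of_mem_bandList (List.mem_of_mem_filter he)).1
    have h1' := (lt_and_adj_of_mem_bandList (List.mem_of_mem_filter he')).1
    rcases Sym2.eq_iff.1 h with ⟨ha, hb⟩ | ⟨ha, hb⟩
    · exact Prod.ext ha hb
    · rw [ha, hb] at h1
      exact absurd h1 h1'.not_gt
  have hsub : ((I.bandList.filter fun p => s(p.1, p.2) ∈ T).map
      fun p => s(p.1, p.2)).toFinset ⊆ T := fun z hz => by
    obtain ⟨e, he, rfl⟩ := List.mem_map.1 (List.mem_toFinset.1 hz)
    simpa using (List.mem_filter.1 he).2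
  have hcard := Finset.card_le_card hsub
  rwa [List.toFinset_card_of_nodup hnd, List.length_map] at hcard

/-- The running time as a power of the size bound `4 * n ^ 2 + 4`. -/
theorem recursiveAlgorithm_time_le {C n k φ : ℕ} (I : BlowUp m (2 * n))
    (T : Finset (Sym2 (Fin m))) (hφ : 1 ≤ φ) (hI : bandwidth I.prototype ≤ φ)
    (hk : k ≤ n) (hT : T.card ≤ n.sqrt) :
    (I.recursiveAlgorithm C n k φ T).time ≤
      ((4 * n ^ 2 + 4) ^ ((C + 12) * φ ^ 2 * (n.sqrt + 1))) ^
        (60000 * (3 * (Nat.log 2 n + 2) + 1)) := by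
  have hm := I.blobs_le
  have hmm : m * m ≤ 2 * n * (2 * n) := Nat.mul_le_mul hm hm
  have hb := I.length_bandList_le
  have he := I.length_edgeList_le
  have hn2 : n ≤ n ^ 2 := Nat.le_self_pow (by norm_num) n
  have hsq : 2 * n * (2 * n) = 4 * n ^ 2 := by ring
  have hφ2 : φ ≤ φ ^ 2 := Nat.le_self_pow (by norm_num) φ
  have hs1 : 1 ≤ φ ^ 2 * (n.sqrt + 1) := Nat.mul_pos (by positivity) (Nat.succ_pos _)
  refine (bbbT_meets hφ (by omega) (by omega) ?_ ?_ (3 * (Nat.log 2 n + 2)) (m + 1) k _ _ _ _ _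
    ⟨?_, ?_, fun b => ?_, ?_, ?_, (I.length_tight_le T).trans hT⟩ ?_ ?_).1
  · calc C + 12 * φ * (n.sqrt + 1)
        ≤ C * (φ ^ 2 * (n.sqrt + 1)) + 12 * φ ^ 2 * (n.sqrt + 1) := by
          gcongr
          exact Nat.le_mul_of_pos_right C hs1
      _ = (C + 12) * φ ^ 2 * (n.sqrt + 1) := by ring
  · calc φ * (3 * φ) * n.sqrt = 3 * φ ^ 2 * n.sqrt := by ring
      _ ≤ (C + 12) * φ ^ 2 * (n.sqrt + 1) := by gcongr <;> omega
  · rw [List.length_finRange]; omega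
  · omega
  · exact (I.length_bands_at_le hI b).trans (by omega)
  · rw [List.length_finRange]; omega
  · omega
  · omega
  · rw [List.length_finRange]
    -- `m ≤ 2 ^ l` and `27 * 2 ≤ 64`, that is, `2 ≤ (4 / 3) ^ 3`
    have hlog : m ≤ 2 ^ (Nat.log 2 n + 2) := by
      have := Nat.lt_pow_succ_log_self (b := 2) (by norm_num) n
      rw [pow_succ]
      omega
    calc m * 3 ^ (3 * (Nat.log 2 n + 2))
        ≤ 2 ^ (Nat.log 2 n + 2) * 3 ^ (3 * (Nat.log 2 n + 2)) := Nat.mul_le_mul_right _ hlog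
      _ = 54 ^ (Nat.log 2 n + 2) := by rw [pow_mul, ← mul_pow]; norm_num
      _ ≤ 64 ^ (Nat.log 2 n + 2) := Nat.pow_le_pow_left (by norm_num) _
      _ = 4 ^ (3 * (Nat.log 2 n + 2)) := by rw [pow_mul]; norm_num

theorem recursiveAlgorithm_time_le_rpow {C n k φ : ℕ} (I : BlowUp m (2 * n))
    (T : Finset (Sym2 (Fin m))) (hn : 2 ≤ n) (hφ : 1 ≤ φ) (hI : bandwidth I.prototype ≤ φ)
    (hk : k ≤ n) (hT : (T.card : ℝ) ≤ Real.sqrt n) :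
    ((I.recursiveAlgorithm C n k φ T).time : ℝ) ≤
      (2 : ℝ) ^ (6000000 * ((C : ℝ) + 12) * (φ : ℝ) ^ 2 * Real.sqrt n * Real.logb 2 n ^ 2) := by
  have hT' : T.card ≤ n.sqrt := by
    rw [Nat.le_sqrt']
    have := (Real.le_sqrt (by positivity) (by positivity)).1 hT
    exact_mod_cast this
  have htime := recursiveAlgorithm_time_le (C := C) I T hφ hI hk hT'
  have hn' : (2 : ℝ) ≤ n := by exact_mod_cast hn
  have hn0 : (0 : ℝ) < n := by linarith
  set l := Real.logb 2 n with hl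
  have hl1 : 1 ≤ l := by
    rw [hl, Real.le_logb_iff_rpow_le (by norm_num) hn0]
    simpa using hn'
  have hs1 : 1 ≤ Real.sqrt n := Real.one_le_sqrt.2 (by linarith)
  have hW : 4 * n ^ 2 + 4 ≤ n ^ 5 := by
    have h8 : 2 ^ 3 ≤ n ^ 3 := Nat.pow_le_pow_left hn 3
    have h4 : 2 ^ 2 ≤ n ^ 2 := Nat.pow_le_pow_left hn 2
    calc 4 * n ^ 2 + 4 ≤ 8 * n ^ 2 := by omega
      _ ≤ n ^ 3 * n ^ 2 := Nat.mul_le_mul_right _ (by omega)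
      _ = n ^ 5 := by ring
  set D := (C + 12) * φ ^ 2 * (n.sqrt + 1) with hD
  set L := 60000 * (3 * (Nat.log 2 n + 2) + 1) with hL
  have hDr : (D : ℝ) ≤ ((C : ℝ) + 12) * (φ : ℝ) ^ 2 * (2 * Real.sqrt n) := by
    rw [hD]
    push_cast
    have : (n.sqrt : ℝ) ≤ Real.sqrt n := Real.nat_sqrt_le_real_sqrt
    gcongr
    linarith
  have hLr : (L : ℝ) ≤ 600000 * l := by
    rw [hL]
    push_cast
    have : (Nat.log 2 n : ℝ) ≤ l := by
      have := Real.natLog_le_logb n 2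
      exact_mod_cast this
    linarith
  calc ((I.recursiveAlgorithm C n k φ T).time : ℝ) ≤ (((n ^ 5) ^ D) ^ L : ℕ) := by
        refine Nat.cast_le.2 (htime.trans ?_)
        gcongr
    _ = (n : ℝ) ^ ((5 * D * L : ℕ) : ℝ) := by
        rw [Real.rpow_natCast]
        push_cast
        rw [← pow_mul, ← pow_mul, ← mul_assoc]
    _ = (2 : ℝ) ^ (l * (5 * D * L)) := by
        conv_lhs => rw [← Real.rpow_logb (b := 2) (by norm_num) (by norm_num) hn0]
        rw [← Real.rpow_mul (by norm_num)]
        push_cast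
        rfl
    _ ≤ _ := by
        refine Real.rpow_le_rpow_of_exponent_le (by norm_num) ?_
        calc l * (5 * D * L)
            ≤ l * (5 * (((C : ℝ) + 12) * (φ : ℝ) ^ 2 * (2 * Real.sqrt n)) * (600000 * l)) := by
              gcongr
          _ = _ := by ring

end BlowUp

/-- The exponent is sublinear if `φ = o(n ^ (1 / 4) / log n)`. -/
theorem isLittleO_exponent (c : ℝ) {φ : ℕ → ℕ}
    (h : (fun n : ℕ => (φ n : ℝ)) =o[Filter.atTop]
      (fun n : ℕ => (n : ℝ) ^ (1 / 4 : ℝ) / Real.logb 2 n)) :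
    (fun n : ℕ => c * (φ n : ℝ) ^ 2 * Real.sqrt n * Real.logb 2 n ^ 2)
      =o[Filter.atTop] (fun n : ℕ => (n : ℝ)) := by
  have h1 := ((h.pow two_pos).mul_isBigO (Asymptotics.isBigO_refl
    (fun n : ℕ => Real.sqrt n * Real.logb 2 n ^ 2) Filter.atTop)).const_mul_left c
  refine (h1.congr_left fun n => by ring).congr' Filter.EventuallyEq.rfl ?_
  filter_upwards [Filter.eventually_ge_atTop 2] with n hn
  have hn' : (2 : ℝ) ≤ n := by exact_mod_cast hn
  have hl : Real.logb 2 n ≠ 0 := (Real.logb_pos (by norm_num) (by linarith)).ne'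
  have hq : ((n : ℝ) ^ (1 / 4 : ℝ)) ^ 2 = Real.sqrt n := by
    rw [Real.sqrt_eq_rpow, ← Real.rpow_natCast, ← Real.rpow_mul (by positivity)]
    norm_num
  rw [div_pow, hq]
  have hsq := Real.mul_self_sqrt (show (0 : ℝ) ≤ n by positivity)
  field_simp
  nlinarith [hsq]

end TkPM

theorem mainTheorem3 (C : ℕ) :
    (∃ c : ℝ, 0 < c ∧
      ∀ (n m k φ : ℕ) (I : TkPM.BlowUp m (2 * n)) (T : Finset (Sym2 (Fin m))),
        2 ≤ n → 1 ≤ φ → TkPM.bandwidth I.prototype ≤ φ → k ≤ n →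
        (∀ B ∈ T, B ∈ I.prototype.edgeSet) → (T.card : ℝ) ≤ Real.sqrt n →
        ((I.recursiveAlgorithm C n k φ T).time : ℝ) ≤
          (2 : ℝ) ^ (c * (φ : ℝ) ^ 2 * Real.sqrt n * Real.logb 2 n ^ 2)) ∧
    (∀ φ : ℕ → ℕ,
      (fun n : ℕ => (φ n : ℝ)) =o[Filter.atTop]
        (fun n : ℕ => (n : ℝ) ^ (1 / 4 : ℝ) / Real.logb 2 n) →
      ∃ g : ℕ → ℝ, g =o[Filter.atTop] (fun n : ℕ => (n : ℝ)) ∧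
        ∀ᶠ n : ℕ in Filter.atTop,
          ∀ (m k : ℕ) (I : TkPM.BlowUp m (2 * n)) (T : Finset (Sym2 (Fin m))),
            1 ≤ φ n → TkPM.bandwidth I.prototype ≤ φ n → k ≤ n →
            (∀ B ∈ T, B ∈ I.prototype.edgeSet) → (T.card : ℝ) ≤ Real.sqrt n →
            ((I.recursiveAlgorithm C n k (φ n) T).time : ℝ) ≤ (2 : ℝ) ^ g n) := by
  have hc : (0 : ℝ) < 6000000 * ((C : ℝ) + 12) := by positivity
  refine ⟨⟨6000000 * ((C : ℝ) + 12), hc, fun n m k φ I T hn hφ hI hk _ hT =>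
    I.recursiveAlgorithm_time_le_rpow T hn hφ hI hk hT⟩, fun φ hφ =>
    ⟨_, TkPM.isLittleO_exponent (6000000 * ((C : ℝ) + 12)) hφ, ?_⟩⟩
  filter_upwards [Filter.eventually_ge_atTop 2] with n hn m k I T hφn hI hk _ hT
  exact I.recursiveAlgorithm_time_le_rpow T hn hφn hI hk hT
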